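/- For an integer $m\ge 1$, let $B^{\mathrm{pol}}_{\mathbb C,m}$ denote the best (smallest) constant $D\ge 0$ such that, for every $n\ge 1$ and every $m$-homogeneous polynomial $P(z)=\sum_{|\alpha|=m}a_\alpha z^\alpha$ on $\mathbb C^n$, $$\Big(\sum_{|\alpha|=m}|a_\alpha|^{\frac{2m}{m+1}}\Big)^{\frac{m+1}{2m}}\le D\,\sup_{z\in\mathbb D^n}|P(z)|,$$ where $\mathbb D$ is the open unit disk in $\mathbb C$ (and $B^{\mathrm{pol}}_{\mathbb C,m}=\infty$ if there is no such constant). Then for every $\kappa_2>1$ there is $\kappa_1>0$ such that, for all $m\ge 1$, $$B^{\mathrm{pol}}_{\mathbb C,m}\le \kappa_1\exp\big(\kappa_2\sqrt{m\log m}\big).$$ -/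

import Mathlib

open scoped NNReal ENNReal

noncomputable section

/-- The norm `‖P‖_∞ = sup { |P(z)| : z ∈ 𝔻ⁿ }` of a polynomial on the open unit polydisk.
The polydisk is nonempty and bounded, so this supremum of reals is a genuine one. -/
def polydiskNorm {n : ℕ} (P : MvPolynomial (Fin n) ℂ) : ℝ :=
  ⨆ z : {z : Fin n → ℂ // ∀ i, ‖z i‖ < 1}, ‖MvPolynomial.eval z.1 P‖

/-- `(∑_{|α| = m} |a_α|^{2m/(m+1)})^{(m+1)/(2m)}` for an `m`-homogeneous polynomial
`P = ∑_{|α| = m} a_α z^α`, where `m ≥ 1`. The sum runs over the `α` with `a_α ≠ 0`. -/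
def coeffNorm (m : ℕ) {n : ℕ} (P : MvPolynomial (Fin n) ℂ) : ℝ :=
  (∑ α ∈ P.support, ‖P.coeff α‖ ^ ((2 * m : ℝ) / (m + 1))) ^ (((m : ℝ) + 1) / (2 * m))

/-- `D` is an admissible constant in the polynomial Bohnenblust-Hille inequality of degree `m`
over `ℂ`, uniformly in the number `n` of variables. -/
def IsPolBHConstant (m : ℕ) (D : ℝ≥0) : Prop :=
  ∀ n : ℕ, 1 ≤ n → ∀ P : MvPolynomial (Fin n) ℂ, P.IsHomogeneous m →
    coeffNorm m P ≤ D * polydiskNorm P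

/-- The best constant in the polynomial Bohnenblust-Hille inequality of degree `m` over `ℂ`,
as an element of `[0, ∞]`; it is `∞` when no finite constant is admissible. -/
def polBHConst (m : ℕ) : ℝ≥0∞ :=
  ⨅ (D : ℝ≥0) (_ : IsPolBHConstant m D), (D : ℝ≥0∞)

end

/-!
Let `P` be `m`-homogeneous in `n` variables and put `q_k = 2k / (k + 1)` (`bhExp`). For an order
`1 ≤ k ≤ m` the coefficients of `P` are regarded as a symmetric function of `m` indices in
`{1, …, n}`. A symmetric form of Blei's inequality (`sum_rpow_bhExp_succ_le`, iterated in
`sum_rpow_bhExp_le`) bounds their `ℓ^{q_m}` norm by a mixed norm that is `ℓ²` in `m - k` of the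
indices and `ℓ^{q_k}` in the others. The inner `ℓ²` norms are, up to the factor
`((m - k)! / m!)^{1/2}`, the `L²` norms on the torus of the partial derivatives of order `k` of `P`
(`sum_coeff_rpow_le_sum_coeffWeight`). It remains to estimate `∑_i ‖∂_i P‖_2^{q_k}`, where `i` runs
over the sequences of `k` variables.

* The derivatives are homogeneous of degree `m - k`, so that their `L²` norm is at most
  `(1 + δ + 2δ²)^{(m - k)/2}` times their `L^{q_k}` norm, with `δ = 1 / (k - 1)`
  (`rpow_coeffWeight_le_lintegral`). This is dual to the contractive inequality
  `lintegral_torus_rpow_le` on the torus.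
* At a fixed point `z` of the torus, `∑_i |∂_i P(z)|^{q_k}` is estimated by the multilinear
  Bohnenblust-Hille inequality for the `k`-linear form `(w_1, …, w_k) ↦ ∂_{w_1} ⋯ ∂_{w_k} P(z)`
  (`sum_enorm_iterPderiv_rpow_le`), with a constant exponential in `k`. The supremum of this form
  is at most `m^k e^k ‖P‖_∞` by Cauchy's estimate on polydisks of radius `1 / m`.

As `m! / (m - k)! ≥ m^k e^{-k}`, the outcome is the constant
`exp (k log m / 2 + 4k + m (δ + 2δ²) / 2)` (`coeffNorm_le_exp`). With `k` close to `√(m / log m)`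
each of `k log m / 2` and `m δ / 2` is `√(m log m) / 2` up to lower order terms, which gives every
`κ₂ > 1` for large `m`; for the remaining `m` the order `k = m` provides a finite constant.

The contractive inequality has to be sharp to first order in `δ`, as any larger multiple of `δ`
would spoil `κ₂`. In one variable it reads `∫ |f|^{2 + 2δ} ≤ (∑ (1 + δ + 2δ²)^n |f_n|²)^{1 + δ}`
(`integral_norm_rpow_le`). For a square `f = h²` it follows from a cubic Taylor bound for
`t ↦ t^{2 + 2δ}` at the root mean square of `|h|²` and from an inequality between the Dirichlet
energies of `|h|²` and of `h²` (`exists_norm_sq_eq_and_energy_le`). A polynomial without zeros in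
the open disk is a limit of squares, and reflecting zeros out of the disk keeps the modulus on the
circle while it decreases the energy, which reduces the general case to squares.
-/

/-! ### Polynomials on the unit circle -/

open MeasureTheory Polynomial ComplexConjugate in
/-- The point `e^{2πix}` of the unit circle, for `x ∈ ℝ/ℤ`. -/
noncomputable def circlePt (x : AddCircle (1 : ℝ)) : ℂ := fourier 1 x

section CircleInner
open MeasureTheory Polynomial ComplexConjugate

lemma continuous_circlePt : Continuous circlePt := (fourier 1).continuous

@[simp] lemma norm_circlePt (x : AddCircle (1 : ℝ)) : ‖circlePt x‖ = 1 := by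
  rw [circlePt, fourier_apply]; exact Circle.norm_coe _

@[simp] lemma circlePt_mul_conj (x : AddCircle (1 : ℝ)) : circlePt x * conj (circlePt x) = 1 := by
  rw [Complex.mul_conj, Complex.normSq_eq_norm_sq]; simp

lemma circlePt_pow (x : AddCircle (1 : ℝ)) (n : ℕ) : circlePt x ^ n = fourier n x := by
  induction n with
  | zero => simp
  | succ n ih => rw [pow_succ, ih, circlePt, ← fourier_add]; push_cast; rfl

lemma integral_fourier (n : ℤ) :
    ∫ x : AddCircle (1 : ℝ), fourier n x ∂AddCircle.haarAddCircle = if n = 0 then 1 else 0 := by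
  have h := (orthonormal_iff_ite.mp (orthonormal_fourier (T := (1 : ℝ)))) 0 n
  rw [ContinuousMap.inner_toLp (𝕜 := ℂ) AddCircle.haarAddCircle (fourier 0) (fourier n)] at h
  simp only [fourier_zero, map_one, mul_one] at h
  rw [h]
  simp [eq_comm]

lemma integral_circlePt_pow_mul_conj (i j : ℕ) :
    ∫ x, circlePt x ^ i * conj (circlePt x ^ j) ∂AddCircle.haarAddCircle
      = if i = j then 1 else 0 := by
  have : ∀ x, circlePt x ^ i * conj (circlePt x ^ j) = fourier ((i : ℤ) - j) x := by
    intro x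
    rw [circlePt_pow, circlePt_pow, ← fourier_neg, ← fourier_add, sub_eq_add_neg]
  simp_rw [this, integral_fourier]
  simp only [sub_eq_zero, Nat.cast_inj]

/-- Continuous functions on the circle are integrable. -/
lemma Continuous.integrable_haarAddCircle {E : Type*} [NormedAddCommGroup E]
    {f : AddCircle (1 : ℝ) → E}
    (hf : Continuous f) : Integrable f AddCircle.haarAddCircle :=
  hf.integrable_of_hasCompactSupport (HasCompactSupport.of_compactSpace f)

@[fun_prop]
lemma continuous_eval_circlePt (p : ℂ[X]) : Continuous fun x ↦ p.eval (circlePt x) :=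
  p.continuous.comp continuous_circlePt

/-- The inner product `∫ p q̄` of two polynomials on the unit circle. -/
noncomputable def circleInner (p q : ℂ[X]) : ℂ :=
  ∫ x, p.eval (circlePt x) * conj (q.eval (circlePt x)) ∂AddCircle.haarAddCircle

lemma integrable_mul_conj (p q : ℂ[X]) :
    Integrable (fun x ↦ p.eval (circlePt x) * conj (q.eval (circlePt x)))
      AddCircle.haarAddCircle :=
  Continuous.integrable_haarAddCircle (by fun_prop)

lemma circleInner_add_left (p q r : ℂ[X]) :
    circleInner (p + q) r = circleInner p r + circleInner q r := by
  unfold circleInner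
  rw [← integral_add (integrable_mul_conj _ _) (integrable_mul_conj _ _)]
  simp [add_mul]

lemma circleInner_conj (p q : ℂ[X]) : conj (circleInner p q) = circleInner q p := by
  unfold circleInner
  rw [← integral_conj]
  simp [mul_comm]

lemma circleInner_add_right (p q r : ℂ[X]) :
    circleInner p (q + r) = circleInner p q + circleInner p r := by
  rw [← circleInner_conj, circleInner_add_left, map_add, circleInner_conj, circleInner_conj]

lemma circleInner_C_mul_left (c : ℂ) (p q : ℂ[X]) :
    circleInner (C c * p) q = c * circleInner p q := by
  unfold circleInner
  rw [← integral_const_mul]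
  simp [mul_assoc]

lemma circleInner_C_mul_right (c : ℂ) (p q : ℂ[X]) :
    circleInner p (C c * q) = conj c * circleInner p q := by
  rw [← circleInner_conj, circleInner_C_mul_left, map_mul, circleInner_conj]

lemma circleInner_X_mul (p q : ℂ[X]) : circleInner (X * p) (X * q) = circleInner p q := by
  unfold circleInner
  congr 1; ext x
  simp only [eval_mul, eval_X, map_mul]
  linear_combination (eval (circlePt x) p * conj (eval (circlePt x) q)) * circlePt_mul_conj x

lemma circleInner_sum_left {ι : Type*} (s : Finset ι) (f : ι → ℂ[X]) (q : ℂ[X]) :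
    circleInner (∑ i ∈ s, f i) q = ∑ i ∈ s, circleInner (f i) q := by
  classical
  induction s using Finset.induction_on with
  | empty => simp [circleInner]
  | insert a s ha ih => rw [Finset.sum_insert ha, Finset.sum_insert ha, circleInner_add_left, ih]

lemma circleInner_sum_right {ι : Type*} (s : Finset ι) (f : ι → ℂ[X]) (q : ℂ[X]) :
    circleInner q (∑ i ∈ s, f i) = ∑ i ∈ s, circleInner q (f i) := by
  rw [← circleInner_conj, circleInner_sum_left, map_sum]
  simp [circleInner_conj]

lemma circleInner_X_pow (i j : ℕ) :
    circleInner (X ^ i) (X ^ j) = if i = j then 1 else 0 := by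
  simpa [circleInner] using integral_circlePt_pow_mul_conj i j

lemma circleInner_X_pow_right (p : ℂ[X]) (j : ℕ) : circleInner p (X ^ j) = p.coeff j := by
  conv_lhs => rw [p.as_sum_range_C_mul_X_pow]
  rw [circleInner_sum_left]
  simp only [circleInner_C_mul_left, circleInner_X_pow, mul_ite, mul_one, mul_zero,
    Finset.sum_ite_eq', Finset.mem_range]
  split_ifs with h
  · rfl
  · rw [coeff_eq_zero_of_natDegree_lt (by omega)]

lemma circleInner_eq_sum_range (p q : ℂ[X]) {N : ℕ} (hN : q.natDegree < N) :
    circleInner p q = ∑ n ∈ Finset.range N, p.coeff n * conj (q.coeff n) := by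
  conv_lhs => rw [q.as_sum_range' N hN]
  rw [circleInner_sum_right]
  refine Finset.sum_congr rfl fun n _ ↦ ?_
  rw [← C_mul_X_pow_eq_monomial, circleInner_C_mul_right, circleInner_X_pow_right, mul_comm]

lemma circleInner_C_right (p : ℂ[X]) (c : ℂ) : circleInner p (C c) = p.coeff 0 * conj c := by
  have := circleInner_C_mul_right c p (X ^ 0)
  rw [circleInner_X_pow_right, pow_zero, mul_one] at this
  rw [this, mul_comm]

lemma coeff_X_mul_derivative (p : ℂ[X]) (n : ℕ) :
    (X * derivative p).coeff n = n * p.coeff n := by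
  cases n with
  | zero => simp
  | succ n => rw [coeff_X_mul, coeff_derivative]; push_cast; ring

/-- The operator `p ↦ z p'` is symmetric on the circle. -/
lemma circleInner_X_mul_derivative (p q : ℂ[X]) :
    circleInner (X * derivative p) q = circleInner p (X * derivative q) := by
  have h : (X * derivative q).natDegree < q.natDegree + 1 := by
    rw [Nat.lt_succ_iff, natDegree_le_iff_coeff_eq_zero]
    intro n hn
    rw [coeff_X_mul_derivative, coeff_eq_zero_of_natDegree_lt hn, mul_zero]
  rw [circleInner_eq_sum_range _ q (Nat.lt_succ_self _), circleInner_eq_sum_range _ _ h]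
  refine Finset.sum_congr rfl fun n _ ↦ ?_
  simp only [coeff_X_mul_derivative, map_mul, Complex.conj_natCast]
  ring

/-- The square `∑ |p_n|²` of the Hardy norm of a polynomial. -/
noncomputable def hardySq (p : ℂ[X]) : ℝ := p.sum fun _ a ↦ ‖a‖ ^ 2

/-- The Dirichlet energy `∑ n |p_n|²` of a polynomial. -/
noncomputable def dirichletEnergy (p : ℂ[X]) : ℝ := p.sum fun n a ↦ n * ‖a‖ ^ 2

lemma hardySq_eq_sum_range (p : ℂ[X]) {N : ℕ} (hN : p.natDegree < N) :
    hardySq p = ∑ n ∈ Finset.range N, ‖p.coeff n‖ ^ 2 :=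
  p.sum_over_range' (f := fun _ a ↦ ‖a‖ ^ 2) (by simp) N hN

lemma dirichletEnergy_eq_sum_range (p : ℂ[X]) {N : ℕ} (hN : p.natDegree < N) :
    dirichletEnergy p = ∑ n ∈ Finset.range N, n * ‖p.coeff n‖ ^ 2 :=
  p.sum_over_range' (f := fun n a ↦ n * ‖a‖ ^ 2) (by simp) N hN

lemma ofReal_hardySq (p : ℂ[X]) : (hardySq p : ℂ) = circleInner p p := by
  rw [circleInner_eq_sum_range _ p (Nat.lt_succ_self _),
    hardySq_eq_sum_range p (Nat.lt_succ_self _)]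
  push_cast
  refine Finset.sum_congr rfl fun n _ ↦ ?_
  rw [Complex.mul_conj, Complex.normSq_eq_norm_sq]; push_cast; rfl

lemma ofReal_dirichletEnergy (p : ℂ[X]) :
    (dirichletEnergy p : ℂ) = circleInner (X * derivative p) p := by
  rw [circleInner_eq_sum_range _ p (Nat.lt_succ_self _),
    dirichletEnergy_eq_sum_range p (Nat.lt_succ_self _)]
  push_cast
  refine Finset.sum_congr rfl fun n _ ↦ ?_
  rw [coeff_X_mul_derivative, mul_assoc, Complex.mul_conj, Complex.normSq_eq_norm_sq]
  push_cast; rfl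

lemma hardySq_nonneg (p : ℂ[X]) : 0 ≤ hardySq p :=
  Finset.sum_nonneg fun _ _ ↦ by positivity

lemma dirichletEnergy_nonneg (p : ℂ[X]) : 0 ≤ dirichletEnergy p :=
  Finset.sum_nonneg fun _ _ ↦ by positivity

/-- Parseval's identity for a polynomial on the circle. -/
lemma integral_norm_sq_eval (p : ℂ[X]) :
    ∫ x, ‖p.eval (circlePt x)‖ ^ 2 ∂AddCircle.haarAddCircle = hardySq p := by
  have h := ofReal_hardySq p
  unfold circleInner at h
  simp only [Complex.mul_conj, Complex.normSq_eq_norm_sq] at h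
  rw [integral_complex_ofReal] at h
  exact_mod_cast h.symm

end CircleInner

/-! ### The Dirichlet energy of the modulus of a square -/

section Energy
open MeasureTheory Polynomial ComplexConjugate

lemma dirichletEnergy_eq_re (p : ℂ[X]) :
    dirichletEnergy p = (circleInner (X * derivative p) p).re := by
  rw [← ofReal_dirichletEnergy, Complex.ofReal_re]

lemma hardySq_eq_re (p : ℂ[X]) : hardySq p = (circleInner p p).re := by
  rw [← ofReal_hardySq, Complex.ofReal_re]

/-- Polarization of the Dirichlet energy. -/
lemma dirichletEnergy_add (p q : ℂ[X]) :
    dirichletEnergy (p + q) = dirichletEnergy p + dirichletEnergy q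
      + 2 * (circleInner (X * derivative p) q).re := by
  have h : circleInner (X * derivative q) p = conj (circleInner (X * derivative p) q) := by
    rw [circleInner_conj, ← circleInner_X_mul_derivative]
  simp only [dirichletEnergy_eq_re, derivative_add, mul_add, circleInner_add_left,
    circleInner_add_right, h, Complex.add_re, Complex.conj_re]
  ring

lemma hardySq_add (p q : ℂ[X]) :
    hardySq (p + q) = hardySq p + hardySq q + 2 * (circleInner p q).re := by
  have h : circleInner q p = conj (circleInner p q) := by rw [circleInner_conj]
  simp only [hardySq_eq_re, circleInner_add_left,
    circleInner_add_right, h, Complex.add_re, Complex.conj_re]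
  ring

lemma hardySq_X_mul (p : ℂ[X]) : hardySq (X * p) = hardySq p := by
  simp only [hardySq_eq_re, circleInner_X_mul]

lemma re_mul_mul_conj (c w : ℂ) : (c * (conj c * w)).re = ‖c‖ ^ 2 * w.re := by
  rw [← mul_assoc, Complex.mul_conj, Complex.normSq_eq_norm_sq, Complex.re_ofReal_mul]

lemma hardySq_C_mul (c : ℂ) (p : ℂ[X]) : hardySq (C c * p) = ‖c‖ ^ 2 * hardySq p := by
  rw [hardySq_eq_re, circleInner_C_mul_left, circleInner_C_mul_right, re_mul_mul_conj,
    hardySq_eq_re]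

lemma dirichletEnergy_C_mul (c : ℂ) (p : ℂ[X]) :
    dirichletEnergy (C c * p) = ‖c‖ ^ 2 * dirichletEnergy p := by
  have : X * derivative (C c * p) = C c * (X * derivative p) := by
    rw [derivative_C_mul]; ring
  rw [dirichletEnergy_eq_re, this, circleInner_C_mul_left, circleInner_C_mul_right,
    re_mul_mul_conj, dirichletEnergy_eq_re]

lemma dirichletEnergy_X_mul (p : ℂ[X]) :
    dirichletEnergy (X * p) = dirichletEnergy p + hardySq p := by
  have : X * derivative (X * p) = X * (p + X * derivative p) := by
    rw [derivative_mul, derivative_X]; ring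
  rw [dirichletEnergy_eq_re, this, circleInner_X_mul, circleInner_add_left, Complex.add_re,
    dirichletEnergy_eq_re, hardySq_eq_re]
  ring

lemma dirichletEnergy_C_add (c : ℂ) (p : ℂ[X]) :
    dirichletEnergy (C c + p) = dirichletEnergy p := by
  have h1 : circleInner (X * derivative p) (C c) = 0 := by rw [circleInner_C_right]; simp
  have h2 : X * derivative (C c + p) = X * derivative p := by simp
  rw [dirichletEnergy_eq_re, h2, circleInner_add_right, h1, zero_add, dirichletEnergy_eq_re]

/-- If `|k|² = s + G + Ḡ` on the circle, then `∫ p Ḡ = ∫ p |k|²` for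
polynomials `p` with `p(0) = 0`. -/
lemma circleInner_eq_of_norm_sq_eq {k G : ℂ[X]} {s : ℝ}
    (hG : ∀ z : ℂ, ‖z‖ = 1 → ((‖k.eval z‖ ^ 2 : ℝ) : ℂ) = s + G.eval z + conj (G.eval z))
    {p : ℂ[X]} (hp : p.coeff 0 = 0) : circleInner p G = circleInner (p * k) k := by
  have h1 : circleInner (p * k) k = circleInner (C (s : ℂ) * p + p * G) 1 + circleInner p G := by
    simp only [circleInner]
    rw [← integral_add ((integrable_mul_conj _ _)) (integrable_mul_conj _ _)]
    congr 1; ext x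
    have := hG (circlePt x) (norm_circlePt x)
    simp only [eval_mul, eval_add, eval_C, eval_one, map_one, mul_one]
    rw [mul_assoc, Complex.mul_conj, Complex.normSq_eq_norm_sq, this]
    ring
  have h2 : circleInner (C (s : ℂ) * p + p * G) 1 = 0 := by
    rw [← C_1, circleInner_C_right]; simp [hp, mul_coeff_zero]
  rw [h1, h2, zero_add]

/-- The energy of the modulus of the square of a polynomial: if `|h|² = ‖h‖² + G + Ḡ` on the
circle, then `4 ∑ n |G_n|² ≤ ∑ n |(h²)_n|²`. Writing `h = a + zk`, passing from `k` to `h`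
increases the difference of the two sides by exactly `2‖k²‖²`. -/
lemma exists_norm_sq_eq_and_energy_le (h : ℂ[X]) : ∃ G : ℂ[X], G.coeff 0 = 0 ∧
    (∀ z : ℂ, ‖z‖ = 1 →
      ((‖h.eval z‖ ^ 2 : ℝ) : ℂ) = hardySq h + G.eval z + conj (G.eval z)) ∧
    4 * dirichletEnergy G ≤ dirichletEnergy (h ^ 2) := by
  induction hd : h.natDegree using Nat.strong_induction_on generalizing h with
  | _ d ih =>
  rcases Nat.eq_zero_or_pos d with hd0 | hd0
  · obtain ⟨a, ha⟩ := natDegree_eq_zero.mp (hd.trans hd0)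
    refine ⟨0, by simp, fun z _ ↦ ?_, ?_⟩
    · rw [← ha, hardySq_eq_re, circleInner_C_right]
      simp [Complex.mul_conj, Complex.normSq_eq_norm_sq]
      norm_cast
    · have h0 : dirichletEnergy (0 : ℂ[X]) = 0 := by simp [dirichletEnergy]
      rw [h0, mul_zero]
      exact dirichletEnergy_nonneg _
  obtain ⟨G, hG0, hG, hE⟩ := ih (h.divX.natDegree)
    (by rw [natDegree_divX_eq_natDegree_tsub_one]; omega) h.divX rfl
  set k := h.divX with hk
  set a := h.coeff 0 with ha
  have hh : h = C a + X * k := by rw [hk, ha, mul_comm, add_comm, divX_mul_X_add]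
  clear_value k a
  subst hh
  have hs : hardySq (C a + X * k) = ‖a‖ ^ 2 + hardySq k := by
    have h1 : hardySq (C a) = ‖a‖ ^ 2 := by
      have := hardySq_C_mul a 1
      rw [mul_one] at this
      rw [this, hardySq_eq_re, ← C_1, circleInner_C_right]; simp
    have h2 : circleInner (C a) (X * k) = 0 := by
      rw [← circleInner_conj, circleInner_C_right]; simp
    rw [hardySq_add, h1, h2, hardySq_X_mul]; simp
  refine ⟨C (conj a) * (X * k) + G, by simp [hG0], fun z hz ↦ ?_, ?_⟩
  · have h1 := hG z hz
    have hz2 : z * conj z = 1 := by rw [Complex.mul_conj, Complex.normSq_eq_norm_sq, hz]; simp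
    have h3 : ∀ w : ℂ, ((‖w‖ ^ 2 : ℝ) : ℂ) = w * conj w := by
      intro w; rw [Complex.mul_conj, Complex.normSq_eq_norm_sq]
    rw [hs]
    rw [h3] at h1 ⊢
    rw [Complex.ofReal_add, h3]
    simp only [eval_add, eval_C, eval_mul, eval_X, map_add, map_mul, Complex.conj_conj]
    linear_combination h1 + (eval z k * conj (eval z k)) * hz2
  · have e1 : (C a + X * k) ^ 2 = C (a ^ 2) + X * (C (2 * a) * k + X * k ^ 2) := by
      simp only [C_mul, C_pow, C_ofNat]; ring
    -- the two cross terms agree: both reduce to trilinear expressions in `k, k, k̄`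
    have e2 : circleInner (X * derivative (C (conj a) * (X * k))) G
        = conj a * circleInner (X * k ^ 2 + X ^ 2 * k * derivative k) k := by
      have h1 : X * derivative (C (conj a) * (X * k))
          = C (conj a) * (X * (k + X * derivative k)) := by
        rw [derivative_C_mul, derivative_mul, derivative_X]; ring
      rw [h1, circleInner_C_mul_left, circleInner_eq_of_norm_sq_eq hG (by simp)]
      congr 2; ring
    have e3 : circleInner (X * k ^ 2) (k + X * derivative k)
        = 2 * circleInner (X * k ^ 2 + X ^ 2 * k * derivative k) k := by
      rw [circleInner_add_right, ← circleInner_X_mul_derivative, ← circleInner_add_left]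
      have : X * k ^ 2 + X * derivative (X * k ^ 2)
          = C 2 * (X * k ^ 2 + X ^ 2 * k * derivative k) := by
        rw [derivative_mul, derivative_X, derivative_pow]
        have h2 : (C (2 : ℂ) : ℂ[X]) = 2 := rfl
        simp [h2]; ring
      rw [this, circleInner_C_mul_left]
    have e4 : (circleInner (X * derivative (C (2 * a) * k)) (X * k ^ 2)).re
        + (circleInner (C (2 * a) * k) (X * k ^ 2)).re
        = 4 * (conj a * circleInner (X * k ^ 2 + X ^ 2 * k * derivative k) k).re := by
      have h1 : X * derivative (C (2 * a) * k) + C (2 * a) * k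
          = C (2 * a) * (k + X * derivative k) := by
        rw [derivative_C_mul]; ring
      rw [← Complex.add_re, ← circleInner_add_left, h1, circleInner_C_mul_left,
        ← Complex.conj_re, map_mul, circleInner_conj, e3]
      have : conj (2 * a) * (2 * circleInner (X * k ^ 2 + X ^ 2 * k * derivative k) k)
        = ((4 : ℝ) : ℂ) * (conj a * circleInner (X * k ^ 2 + X ^ 2 * k * derivative k) k) := by
        simp only [map_mul, Complex.conj_ofNat]; push_cast; ring
      rw [this, Complex.re_ofReal_mul]
    have n1 : ‖conj a‖ = ‖a‖ := Complex.norm_conj a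
    have n2 : ‖2 * a‖ ^ 2 = 4 * ‖a‖ ^ 2 := by rw [norm_mul]; norm_num; ring
    rw [e1, dirichletEnergy_C_add, dirichletEnergy_X_mul, dirichletEnergy_add, hardySq_add,
      dirichletEnergy_add, e2, dirichletEnergy_X_mul, hardySq_X_mul, hardySq_C_mul,
      dirichletEnergy_C_mul, dirichletEnergy_C_mul, dirichletEnergy_X_mul, n1, n2]
    have := hardySq_nonneg (k ^ 2)
    linarith

end Energy

/-! ### A cubic Taylor bound and the cubic moment -/

section Cubic
open MeasureTheory Polynomial ComplexConjugate

/-- For `2 ≤ q ≤ 3` the power `s ^ q` lies below its cubic Taylor polynomial at `1`. -/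
lemma rpow_le_cubic {s q : ℝ} (hs : 0 ≤ s) (hq2 : 2 ≤ q) (hq3 : q ≤ 3) :
    s ^ q ≤ 1 + q * (s - 1) + q * (q - 1) / 2 * (s - 1) ^ 2
      + q * (q - 1) * (q - 2) / 6 * (s - 1) ^ 3 := by
  let D : ℝ → ℝ := fun s ↦ 1 + q * (s - 1) + q * (q - 1) / 2 * (s - 1) ^ 2
      + q * (q - 1) * (q - 2) / 6 * (s - 1) ^ 3 - s ^ q
  let D' : ℝ → ℝ := fun s ↦ q + q * (q - 1) * (s - 1)
      + q * (q - 1) * (q - 2) / 2 * (s - 1) ^ 2 - q * s ^ (q - 1)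
  let D'' : ℝ → ℝ := fun s ↦ q * (q - 1)
      + q * (q - 1) * (q - 2) * (s - 1) - q * ((q - 1) * s ^ (q - 2))
  have h1 : ∀ x, HasDerivAt D (D' x) x := by
    intro x
    have hr := Real.hasDerivAt_rpow_const (x := x) (p := q) (Or.inr (by linarith))
    have hx := (hasDerivAt_id x).sub_const 1
    have := ((((hx.const_mul q).const_add 1).add ((hx.pow 2).const_mul (q * (q - 1) / 2))).add
      ((hx.pow 3).const_mul (q * (q - 1) * (q - 2) / 6))).sub hr
    refine this.congr_deriv ?_
    simp [D']; ring
  have h2 : ∀ x, HasDerivAt D' (D'' x) x := by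
    intro x
    have hr := (Real.hasDerivAt_rpow_const (x := x) (p := q - 1) (Or.inr (by linarith))).const_mul q
    have hx := (hasDerivAt_id x).sub_const 1
    have := (((hx.const_mul (q * (q - 1))).const_add q).add
      ((hx.pow 2).const_mul (q * (q - 1) * (q - 2) / 2))).sub hr
    rw [show q - 1 - 1 = q - 2 by ring] at this
    refine this.congr_deriv ?_
    simp [D'']; ring
  have h3 : ∀ x ∈ interior (Set.Ici (0 : ℝ)), 0 ≤ D'' x := by
    intro x hx
    rw [interior_Ici] at hx
    have hx : 0 < x := hx
    have hb := rpow_one_add_le_one_add_mul_self (s := x - 1) (p := q - 2) (by linarith)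
      (by linarith) (by linarith)
    rw [show 1 + (x - 1) = x by ring] at hb
    have hqq : 0 ≤ q * (q - 1) := mul_nonneg (by linarith) (by linarith)
    have := mul_le_mul_of_nonneg_left hb hqq
    simp only [D'']
    linarith
  have hconv : ConvexOn ℝ (Set.Ici (0 : ℝ)) D :=
    convexOn_of_hasDerivWithinAt2_nonneg (convex_Ici 0)
      (fun x _ ↦ (h1 x).continuousAt.continuousWithinAt)
      (fun x _ ↦ (h1 x).hasDerivWithinAt) (fun x _ ↦ (h2 x).hasDerivWithinAt) h3
  have hD1 : HasDerivAt D 0 1 := (h1 1).congr_deriv (by simp [D'])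
  have h4 : D 1 ≤ D s := by
    rcases lt_trichotomy s 1 with h | rfl | h
    · have := hconv.slope_le_of_hasDerivAt (Set.mem_Ici.mpr hs) (Set.mem_Ici.mpr zero_le_one) h hD1
      rw [slope_def_field, div_le_iff₀ (by linarith)] at this
      linarith
    · rfl
    · have := hconv.le_slope_of_hasDerivAt (Set.mem_Ici.mpr zero_le_one) (Set.mem_Ici.mpr hs) h hD1
      rw [slope_def_field, le_div_iff₀ (by linarith)] at this
      linarith
  simp only [D, sub_self, Real.one_rpow] at h4
  norm_num at h4
  linarith

/-- The cubic form `∫ G² Ḡ` of a polynomial with `G(0) = 0` is controlled by its Dirichlet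
energy and its Hardy norm: the `n`-th coefficient of `G²` has only `n - 1` terms. -/
lemma re_circleInner_sq_le {G : ℂ[X]} (h0 : G.coeff 0 = 0) {l : ℝ} (hl : 0 < l) :
    (circleInner (G ^ 2) G).re
      ≤ l * (dirichletEnergy G - hardySq G) + hardySq G ^ 2 / (4 * l) := by
  set N := G.natDegree + 1 with hN
  have hdeg : G.natDegree < N := Nat.lt_succ_self _
  have key : ∀ n ∈ Finset.range N, ((G ^ 2).coeff n * conj (G.coeff n)).re
      ≤ l * (n * ‖G.coeff n‖ ^ 2 - ‖G.coeff n‖ ^ 2)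
        + (1 / (4 * l)) * ∑ ij ∈ Finset.HasAntidiagonal.antidiagonal n,
          ‖G.coeff ij.1‖ ^ 2 * ‖G.coeff ij.2‖ ^ 2 := by
    intro n _
    rcases Nat.lt_or_ge n 2 with hn | hn
    · have hz : G.coeff n = 0 ∨ n = 1 := by
        interval_cases n <;> simp [h0]
      have hnn : (0:ℝ) ≤ (1 / (4 * l)) *
          ∑ ij ∈ Finset.HasAntidiagonal.antidiagonal n,
            ‖G.coeff ij.1‖ ^ 2 * ‖G.coeff ij.2‖ ^ 2 := by positivity
      have hc : (G ^ 2).coeff n = 0 := by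
        rw [pow_two, coeff_mul]
        refine Finset.sum_eq_zero fun ij hij ↦ ?_
        have := Finset.HasAntidiagonal.mem_antidiagonal.mp hij
        have : ij.1 = 0 ∨ ij.2 = 0 := by omega
        rcases this with h | h <;> simp [h, h0]
      have h1 : (0:ℝ) ≤ l * (n * ‖G.coeff n‖ ^ 2 - ‖G.coeff n‖ ^ 2) := by
        rcases hz with hz | hz <;> simp [hz]
      rw [hc, zero_mul, Complex.zero_re]
      linarith
    · have hcs : ‖(G ^ 2).coeff n‖ ^ 2 ≤ (n - 1 : ℝ) *
          ∑ ij ∈ Finset.HasAntidiagonal.antidiagonal n,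
            ‖G.coeff ij.1‖ ^ 2 * ‖G.coeff ij.2‖ ^ 2 := by
        let S := (Finset.HasAntidiagonal.antidiagonal n).filter fun ij ↦ ij.1 ≠ 0 ∧ ij.2 ≠ 0
        have hS : (S.card : ℝ) ≤ n - 1 := by
          have : S ⊆ (Finset.Ico 1 n).image fun i ↦ (i, n - i) := by
            intro ij hij
            simp only [S, Finset.mem_filter, Finset.HasAntidiagonal.mem_antidiagonal] at hij
            simp only [Finset.mem_image, Finset.mem_Ico]
            exact ⟨ij.1, by omega, Prod.ext rfl (by simp only; omega)⟩
          have := (Finset.card_le_card this).trans Finset.card_image_le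
          rw [Nat.card_Ico] at this
          have h' : ((n - 1 : ℕ) : ℝ) = n - 1 := by push_cast [show 1 ≤ n by omega]; rfl
          rw [← h']; exact_mod_cast this
        have hsum : (G ^ 2).coeff n = ∑ ij ∈ S, G.coeff ij.1 * G.coeff ij.2 := by
          rw [pow_two, coeff_mul, Finset.sum_filter_of_ne]
          intro ij _ hne
          constructor <;> intro h <;> simp [h, h0] at hne
        calc ‖(G ^ 2).coeff n‖ ^ 2 ≤ (∑ ij ∈ S, ‖G.coeff ij.1‖ * ‖G.coeff ij.2‖) ^ 2 := by
              rw [hsum]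
              gcongr
              refine (norm_sum_le _ _).trans (le_of_eq ?_)
              simp
          _ ≤ S.card * ∑ ij ∈ S, (‖G.coeff ij.1‖ * ‖G.coeff ij.2‖) ^ 2 :=
              sq_sum_le_card_mul_sum_sq
          _ ≤ _ := by
              refine mul_le_mul hS ?_ (by positivity) ?_
              · simp_rw [mul_pow]
                exact Finset.sum_le_sum_of_subset_of_nonneg (Finset.filter_subset _ _)
                  fun _ _ _ ↦ by positivity
              · have : (2 : ℝ) ≤ n := by exact_mod_cast hn
                linarith
      have hn1 : (0 : ℝ) < n - 1 := by
        have : (2 : ℝ) ≤ n := by exact_mod_cast hn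
        linarith
      set A := ∑ ij ∈ Finset.HasAntidiagonal.antidiagonal n, ‖G.coeff ij.1‖ ^ 2 * ‖G.coeff ij.2‖ ^ 2
      have h1 : ((G ^ 2).coeff n * conj (G.coeff n)).re ≤ ‖(G ^ 2).coeff n‖ * ‖G.coeff n‖ := by
        refine (Complex.re_le_norm _).trans (le_of_eq ?_)
        rw [norm_mul, Complex.norm_conj]
      set u := ‖(G ^ 2).coeff n‖
      set v := ‖G.coeff n‖
      have h2 : u * v ≤ l * ((n - 1) * v ^ 2) + u ^ 2 / (4 * l * (n - 1)) := by
        have : 0 ≤ (2 * l * (n - 1) * v - u) ^ 2 / (4 * l * (n - 1)) := by positivity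
        have e : (2 * l * (n - 1) * v - u) ^ 2 / (4 * l * (n - 1))
          = l * ((n - 1) * v ^ 2) + u ^ 2 / (4 * l * (n - 1)) - u * v := by
          field_simp; ring
        linarith
      have h3 : u ^ 2 / (4 * l * (n - 1)) ≤ 1 / (4 * l) * A := by
        rw [div_le_iff₀ (by positivity)]
        have : 1 / (4 * l) * A * (4 * l * (n - 1)) = (n - 1) * A := by field_simp
        rw [this]; exact hcs
      linarith
  have hA : ∑ n ∈ Finset.range N, ∑ ij ∈ Finset.HasAntidiagonal.antidiagonal n,
      ‖G.coeff ij.1‖ ^ 2 * ‖G.coeff ij.2‖ ^ 2 ≤ hardySq G ^ 2 := by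
    rw [hardySq_eq_sum_range G hdeg, pow_two, Finset.sum_mul_sum, ← Finset.sum_product',
      Finset.sum_sigma']
    have hinj : Set.InjOn (fun x : (_ : ℕ) × ℕ × ℕ ↦ x.2)
        ((Finset.range N).sigma fun n ↦ Finset.HasAntidiagonal.antidiagonal n) := by
      rintro ⟨n, i, j⟩ hx ⟨m, i', j'⟩ hy hxy
      simp only [Finset.coe_sigma, Set.mem_sigma_iff, Finset.mem_coe,
        Finset.HasAntidiagonal.mem_antidiagonal] at hx hy
      obtain ⟨-, rfl⟩ := hx
      obtain ⟨-, rfl⟩ := hy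
      simp only [Prod.mk.injEq] at hxy
      obtain ⟨rfl, rfl⟩ := hxy
      rfl
    rw [← Finset.sum_image (f := fun ij : ℕ × ℕ ↦ ‖G.coeff ij.1‖ ^ 2 * ‖G.coeff ij.2‖ ^ 2) hinj]
    refine Finset.sum_le_sum_of_subset_of_nonneg ?_ fun _ _ _ ↦ by positivity
    intro ij hij
    simp only [Finset.mem_image, Finset.mem_sigma, Finset.mem_range,
      Finset.HasAntidiagonal.mem_antidiagonal] at hij
    obtain ⟨x, ⟨h1, h2⟩, rfl⟩ := hij
    simp only [Finset.mem_product, Finset.mem_range]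
    omega
  rw [circleInner_eq_sum_range _ _ hdeg, Complex.re_sum]
  refine (Finset.sum_le_sum key).trans ?_
  rw [Finset.sum_add_distrib, ← Finset.mul_sum, ← Finset.mul_sum, Finset.sum_sub_distrib,
    ← dirichletEnergy_eq_sum_range G hdeg, ← hardySq_eq_sum_range G hdeg]
  have : 1 / (4 * l) * ∑ n ∈ Finset.range N, ∑ ij ∈ Finset.HasAntidiagonal.antidiagonal n,
      ‖G.coeff ij.1‖ ^ 2 * ‖G.coeff ij.2‖ ^ 2 ≤ hardySq G ^ 2 / (4 * l) := by
    rw [div_eq_inv_mul (hardySq G ^ 2), one_div]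
    gcongr
  linarith

end Cubic

/-! ### The contractive inequality for squares -/

section Hyper
open MeasureTheory Polynomial ComplexConjugate

/-- The inequality `∫ |f|^{2+2δ} ≤ (∑ (1 + δ(1+2δ) n) |f_n|²)^{1+δ}` on the unit circle. -/
def IsHypercontractive (δ : ℝ) (f : ℂ[X]) : Prop :=
  ∫ x, ‖f.eval (circlePt x)‖ ^ (2 + 2 * δ) ∂AddCircle.haarAddCircle
    ≤ (hardySq f + δ * (1 + 2 * δ) * dirichletEnergy f) ^ (1 + δ)

lemma IsHypercontractive.C_mul {δ : ℝ} (hδ : 0 ≤ δ) {f : ℂ[X]} (hf : IsHypercontractive δ f)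
    (c : ℂ) : IsHypercontractive δ (C c * f) := by
  unfold IsHypercontractive at *
  have h1 : ∀ x, ‖(C c * f).eval (circlePt x)‖ ^ (2 + 2 * δ)
      = ‖c‖ ^ (2 + 2 * δ) * ‖f.eval (circlePt x)‖ ^ (2 + 2 * δ) := by
    intro x
    rw [eval_mul, eval_C, norm_mul, Real.mul_rpow (norm_nonneg _) (norm_nonneg _)]
  simp_rw [h1]
  have hR : 0 ≤ hardySq f + δ * (1 + 2 * δ) * dirichletEnergy f := by
    have := hardySq_nonneg f
    have := dirichletEnergy_nonneg f
    positivity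
  rw [integral_const_mul, hardySq_C_mul, dirichletEnergy_C_mul,
    show ‖c‖ ^ 2 * hardySq f + δ * (1 + 2 * δ) * (‖c‖ ^ 2 * dirichletEnergy f)
      = ‖c‖ ^ 2 * (hardySq f + δ * (1 + 2 * δ) * dirichletEnergy f) by ring,
    Real.mul_rpow (by positivity) hR, ← Real.rpow_natCast, ← Real.rpow_mul (norm_nonneg _),
    show ((2 : ℕ) : ℝ) * (1 + δ) = 2 + 2 * δ by push_cast; ring]
  gcongr

/-- Moments of `|h|² = 1 + G + Ḡ`. -/
lemma integral_norm_sq_pow {h G : ℂ[X]} (h0 : G.coeff 0 = 0)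
    (hG : ∀ z : ℂ, ‖z‖ = 1 → ((‖h.eval z‖ ^ 2 : ℝ) : ℂ) = (1 : ℝ) + G.eval z + conj (G.eval z)) :
    (∫ x, (‖h.eval (circlePt x)‖ ^ 2) ^ 2 ∂AddCircle.haarAddCircle = 1 + 2 * hardySq G) ∧
    (∫ x, (‖h.eval (circlePt x)‖ ^ 2) ^ 3 ∂AddCircle.haarAddCircle
      = 1 + 6 * hardySq G + 6 * (circleInner (G ^ 2) G).re) := by
  have hint : ∀ p q : ℂ[X], ∀ c : ℂ, Integrable
      (fun x ↦ c * (p.eval (circlePt x) * conj (q.eval (circlePt x))))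
      AddCircle.haarAddCircle := fun p q c ↦ (integrable_mul_conj p q).const_mul c
  have hdef : ∀ p q : ℂ[X], ∫ x, p.eval (circlePt x) * conj (q.eval (circlePt x))
      ∂AddCircle.haarAddCircle = circleInner p q := fun _ _ ↦ rfl
  constructor
  · have e : ∀ x, (((‖h.eval (circlePt x)‖ ^ 2) ^ 2 : ℝ) : ℂ)
        = 1 * ((1 + C 2 * G + G ^ 2).eval (circlePt x) * conj ((1 : ℂ[X]).eval (circlePt x)))
        + 1 * ((1 : ℂ[X]).eval (circlePt x) * conj ((C 2 * G + G ^ 2).eval (circlePt x)))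
        + 2 * (G.eval (circlePt x) * conj (G.eval (circlePt x))) := by
      intro x
      rw [Complex.ofReal_pow, hG _ (norm_circlePt x)]
      simp only [eval_add, eval_mul, eval_pow, eval_C, eval_one, map_add, map_mul, map_pow, map_one,
        Complex.conj_ofNat]
      push_cast; ring
    have : ((∫ x, (‖h.eval (circlePt x)‖ ^ 2) ^ 2 ∂AddCircle.haarAddCircle : ℝ) : ℂ)
        = 1 + 2 * hardySq G := by
      rw [← integral_complex_ofReal]
      simp_rw [e]
      rw [integral_add (by exact (hint _ _ _).add (hint _ _ _)) (hint _ _ _),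
        integral_add (hint _ _ _) (hint _ _ _)]
      simp only [integral_const_mul, hdef]
      rw [ofReal_hardySq, ← circleInner_conj _ (1 : ℂ[X]), ← C_1, circleInner_C_right,
        circleInner_C_right]
      simp [h0, pow_two]
    exact_mod_cast this
  · have e : ∀ x, (((‖h.eval (circlePt x)‖ ^ 2) ^ 3 : ℝ) : ℂ)
        = 1 * ((1 + C 3 * G + C 3 * G ^ 2 + G ^ 3).eval (circlePt x)
            * conj ((1 : ℂ[X]).eval (circlePt x)))
        + 1 * ((1 : ℂ[X]).eval (circlePt x)
            * conj ((C 3 * G + C 3 * G ^ 2 + G ^ 3).eval (circlePt x)))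
        + 6 * (G.eval (circlePt x) * conj (G.eval (circlePt x)))
        + 3 * ((G ^ 2).eval (circlePt x) * conj (G.eval (circlePt x)))
        + 3 * (G.eval (circlePt x) * conj ((G ^ 2).eval (circlePt x))) := by
      intro x
      rw [Complex.ofReal_pow, hG _ (norm_circlePt x)]
      simp only [eval_add, eval_mul, eval_pow, eval_C, eval_one, map_add, map_mul, map_pow, map_one,
        Complex.conj_ofNat]
      push_cast; ring
    have : ((∫ x, (‖h.eval (circlePt x)‖ ^ 2) ^ 3 ∂AddCircle.haarAddCircle : ℝ) : ℂ)
        = 1 + 6 * hardySq G + 3 * (circleInner (G ^ 2) G + conj (circleInner (G ^ 2) G)) := by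
      rw [← integral_complex_ofReal]
      simp_rw [e]
      rw [integral_add
          (by exact (((hint _ _ _).add (hint _ _ _)).add (hint _ _ _)).add (hint _ _ _))
          (hint _ _ _),
        integral_add (by exact ((hint _ _ _).add (hint _ _ _)).add (hint _ _ _)) (hint _ _ _),
        integral_add (by exact (hint _ _ _).add (hint _ _ _)) (hint _ _ _),
        integral_add (hint _ _ _) (hint _ _ _)]
      simp only [integral_const_mul, hdef]
      rw [ofReal_hardySq, ← circleInner_conj _ (1 : ℂ[X]), ← C_1, circleInner_C_right,
        circleInner_C_right, circleInner_conj]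
      simp [h0, pow_succ]
      ring
    rw [Complex.add_conj] at this
    have h2 : ((∫ x, (‖h.eval (circlePt x)‖ ^ 2) ^ 3 ∂AddCircle.haarAddCircle : ℝ) : ℂ)
        = ((1 + 6 * hardySq G + 3 * (2 * (circleInner (G ^ 2) G).re) : ℝ) : ℂ) := by
      rw [this]; push_cast; ring
    have h3 := Complex.ofReal_injective h2
    rw [h3]; ring

/-- The scalar inequality behind the hypercontractive estimate: `l²` is the second moment,
`c` the third moment, `E` the Dirichlet energy and `b` the cubic form of `|h|² = 1 + G + Ḡ`. -/
lemma cubic_moment_le {δ l x b E : ℝ} (hδ : 0 ≤ δ) (hl : 1 ≤ l) (hx : l ^ 2 = 1 + 2 * x)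
    (hb : b ≤ l * (E - x) + x ^ 2 / (4 * l)) :
    (1 - 1 / l) + (1 + 2 * δ) / 6 * ((1 + 6 * x + 6 * b) / l ^ 3 - 4 + 3 / l)
      ≤ (1 + 2 * δ) * (E / l ^ 2) := by
  have hl0 : 0 < l := by linarith
  obtain rfl : x = (l ^ 2 - 1) / 2 := by linarith
  have h1 : 1 - 1 / l ≤ (1 + 2 * δ) * (1 - 1 / l) := by
    have : 1 / l ≤ 1 := by rw [div_le_one hl0]; exact hl
    nlinarith
  have h2 : b / l ^ 3 ≤ (E - (l ^ 2 - 1) / 2) / l ^ 2 + (l ^ 2 - 1) ^ 2 / (16 * l ^ 4) := by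
    rw [div_le_iff₀ (by positivity)]
    refine hb.trans (le_of_eq ?_)
    field_simp; ring
  have h3 : (1 - 1 / l) + 1 / 6 * ((1 + 6 * ((l ^ 2 - 1) / 2) + 6 * b) / l ^ 3 - 4 + 3 / l)
      ≤ E / l ^ 2 := by
    have e : (1 - 1 / l) + 1 / 6 * ((1 + 6 * ((l ^ 2 - 1) / 2) + 6 * b) / l ^ 3 - 4 + 3 / l)
      = b / l ^ 3 + (1 / 3 - 1 / (3 * l ^ 3)) := by field_simp; ring
    have e2 : (E - (l ^ 2 - 1) / 2) / l ^ 2 + (l ^ 2 - 1) ^ 2 / (16 * l ^ 4)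
        + (1 / 3 - 1 / (3 * l ^ 3))
      = E / l ^ 2 - (l - 1) ^ 2 * (5 * l ^ 2 + 10 * l - 3) / (48 * l ^ 4) := by field_simp; ring
    have h4 : 0 ≤ (l - 1) ^ 2 * (5 * l ^ 2 + 10 * l - 3) / (48 * l ^ 4) := by
      have : 0 ≤ 5 * l ^ 2 + 10 * l - 3 := by nlinarith
      positivity
    linarith
  have h5 := mul_le_mul_of_nonneg_left h3 (show 0 ≤ 1 + 2 * δ by linarith)
  linarith

/-- Squares of polynomials are hypercontractive, in the normalised case `‖h‖ = 1`: the power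
`|h|^{2q}` is bounded by the cubic Taylor polynomial of `t ↦ t^q` at the root mean square `l` of
`|h|²`, and the moments of `|h|²` are controlled by its Dirichlet energy. -/
lemma isHypercontractive_sq_of_hardySq_eq_one {δ : ℝ} (hδ : 0 ≤ δ) (hδ2 : δ ≤ 1 / 2) {h : ℂ[X]}
    (hh : hardySq h = 1) : IsHypercontractive δ (h ^ 2) := by
  obtain ⟨G, h0, hG, hE⟩ := exists_norm_sq_eq_and_energy_le h
  rw [hh] at hG
  obtain ⟨m2, m3⟩ := integral_norm_sq_pow h0 hG
  have m1 := integral_norm_sq_eval h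
  rw [hh] at m1
  set x := hardySq G with hx
  have hx0 : 0 ≤ x := hardySq_nonneg G
  set b := (circleInner (G ^ 2) G).re with hb
  set E := dirichletEnergy G with hEdef
  have hE0 : 0 ≤ E := dirichletEnergy_nonneg G
  set l := √(1 + 2 * x) with hldef
  have hl2 : l ^ 2 = 1 + 2 * x := Real.sq_sqrt (by linarith)
  have hl1 : 1 ≤ l := by rw [hldef, Real.one_le_sqrt]; linarith
  have hl0 : 0 < l := by linarith
  have hbl := re_circleInner_sq_le h0 hl0
  have hkey := cubic_moment_le hδ hl1 hl2 hbl
  have hR : hardySq (h ^ 2) = l ^ 2 := by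
    rw [hl2, ← m2, ← integral_norm_sq_eval]
    simp
  unfold IsHypercontractive
  set q := 2 + 2 * δ with hq
  set φ : AddCircle (1 : ℝ) → ℝ := fun x ↦ ‖h.eval (circlePt x)‖ ^ 2 with hφ
  have hφc : Continuous φ := by fun_prop
  have hφ0 : ∀ x, 0 ≤ φ x := fun x ↦ by positivity
  have i1 : Integrable φ AddCircle.haarAddCircle := hφc.integrable_haarAddCircle
  have i2 : Integrable (fun x ↦ φ x ^ 2) AddCircle.haarAddCircle :=
    (hφc.pow 2).integrable_haarAddCircle
  have i3 : Integrable (fun x ↦ φ x ^ 3) AddCircle.haarAddCircle :=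
    (hφc.pow 3).integrable_haarAddCircle
  -- the coefficients of the cubic Taylor polynomial, expanded in powers of `φ / l`
  have hpt : ∀ x, φ x ^ q ≤ l ^ q * ((1 - q + q * (q - 1) / 2 - q * (q - 1) * (q - 2) / 6)
      + (q - q * (q - 1) + q * (q - 1) * (q - 2) / 2) / l * φ x
      + (q * (q - 1) / 2 - q * (q - 1) * (q - 2) / 2) / l ^ 2 * φ x ^ 2
      + q * (q - 1) * (q - 2) / 6 / l ^ 3 * φ x ^ 3) := by
    intro x
    have h1 := rpow_le_cubic (s := φ x / l) (q := q) (div_nonneg (hφ0 x) hl0.le)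
      (by linarith) (by linarith)
    rw [Real.div_rpow (hφ0 x) hl0.le, div_le_iff₀' (by positivity)] at h1
    refine h1.trans (le_of_eq ?_)
    congr 1
    field_simp
    ring
  have hint : ∫ x, φ x ^ q ∂AddCircle.haarAddCircle
      ≤ l ^ q * ((1 - q + q * (q - 1) / 2 - q * (q - 1) * (q - 2) / 6)
      + (q - q * (q - 1) + q * (q - 1) * (q - 2) / 2) / l * 1
      + (q * (q - 1) / 2 - q * (q - 1) * (q - 2) / 2) / l ^ 2 * (1 + 2 * x)
      + q * (q - 1) * (q - 2) / 6 / l ^ 3 * (1 + 6 * x + 6 * b)) := by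
    have j0 : Integrable (fun _ : AddCircle (1 : ℝ) ↦
        (1 - q + q * (q - 1) / 2 - q * (q - 1) * (q - 2) / 6)) AddCircle.haarAddCircle :=
      integrable_const _
    refine (integral_mono ?_ ?_ hpt).trans (le_of_eq ?_)
    · exact (hφc.rpow_const fun x ↦ Or.inr (by linarith)).integrable_haarAddCircle
    · exact (((j0.add (i1.const_mul _)).add (i2.const_mul _)).add (i3.const_mul _)).const_mul _
    · rw [integral_const_mul, integral_add (by exact (j0.add (i1.const_mul _)).add (i2.const_mul _))
        (i3.const_mul _), integral_add (by exact j0.add (i1.const_mul _)) (i2.const_mul _),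
        integral_add j0 (i1.const_mul _)]
      simp only [integral_const_mul, integral_const, probReal_univ, one_smul]
      rw [m1, m2, m3]
  have hLHS : ∀ x, ‖(h ^ 2).eval (circlePt x)‖ = φ x := fun x ↦ by simp [hφ]
  simp_rw [hLHS]
  refine hint.trans ?_
  have hstep : (l ^ 2 + δ * (1 + 2 * δ) * (4 * E)) ^ (1 + δ)
      ≤ (hardySq (h ^ 2) + δ * (1 + 2 * δ) * dirichletEnergy (h ^ 2)) ^ (1 + δ) := by
    rw [hR]; gcongr
  refine le_trans ?_ hstep
  have e1 : l ^ 2 + δ * (1 + 2 * δ) * (4 * E)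
      = l ^ 2 * (1 + δ * (1 + 2 * δ) * (4 * E) / l ^ 2) := by
    field_simp
  rw [e1, Real.mul_rpow (by positivity) (by positivity), ← Real.rpow_natCast,
    ← Real.rpow_mul hl0.le, show ((2 : ℕ) : ℝ) * (1 + δ) = q by push_cast; ring]
  have hbern := one_add_mul_self_le_rpow_one_add
    (s := δ * (1 + 2 * δ) * (4 * E) / l ^ 2) (p := 1 + δ)
    (le_trans (by norm_num) (show (0:ℝ) ≤ _ by positivity)) (by linarith)
  rw [Real.rpow_natCast]
  refine mul_le_mul_of_nonneg_left (le_trans ?_ hbern) (by positivity)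
  have hk2 := mul_le_mul_of_nonneg_left hkey (show 0 ≤ 4 * δ * (1 + δ) by positivity)
  have e3 : (1 - q + q * (q - 1) / 2 - q * (q - 1) * (q - 2) / 6)
      + (q - q * (q - 1) + q * (q - 1) * (q - 2) / 2) / l * 1
      + (q * (q - 1) / 2 - q * (q - 1) * (q - 2) / 2) / l ^ 2 * (1 + 2 * x)
      + q * (q - 1) * (q - 2) / 6 / l ^ 3 * (1 + 6 * x + 6 * b)
      = 1 + 4 * δ * (1 + δ) *
        ((1 - 1 / l) + (1 + 2 * δ) / 6 * ((1 + 6 * x + 6 * b) / l ^ 3 - 4 + 3 / l)) := by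
    rw [← hl2, hq]
    field_simp
    ring
  have e4 : (1 + δ) * (δ * (1 + 2 * δ) * (4 * E) / l ^ 2)
      = 4 * δ * (1 + δ) * ((1 + 2 * δ) * (E / l ^ 2)) := by ring
  rw [e3, e4]
  linarith

lemma isHypercontractive_sq {δ : ℝ} (hδ : 0 ≤ δ) (hδ2 : δ ≤ 1 / 2) (h : ℂ[X]) :
    IsHypercontractive δ (h ^ 2) := by
  rcases (hardySq_nonneg h).eq_or_lt with hs | hs
  · have : h = 0 := by
      ext n
      have h1 := hardySq_eq_sum_range h (N := max (h.natDegree + 1) (n + 1))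
        (lt_of_lt_of_le (Nat.lt_succ_self _) (le_max_left _ _))
      rw [← hs, eq_comm, Finset.sum_eq_zero_iff_of_nonneg (fun _ _ ↦ by positivity)] at h1
      simpa using h1 n (by simp)
    subst this
    have h1 : (2 + 2 * δ) ≠ 0 := by positivity
    have h2 : (1 + δ) ≠ 0 := by positivity
    simp [IsHypercontractive, hardySq, dirichletEnergy, Real.zero_rpow h1, Real.zero_rpow h2]
  · set c : ℂ := (((√(hardySq h))⁻¹ : ℝ) : ℂ) with hc
    have hc0 : c ≠ 0 := by
      rw [hc]; exact_mod_cast (inv_pos.mpr (Real.sqrt_pos.mpr hs)).ne'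
    have h1 : hardySq (C c * h) = 1 := by
      rw [hardySq_C_mul, hc, Complex.norm_real, Real.norm_eq_abs, sq_abs, inv_pow,
        Real.sq_sqrt hs.le, inv_mul_cancel₀ hs.ne']
    have h2 := (isHypercontractive_sq_of_hardySq_eq_one hδ hδ2 h1).C_mul hδ ((c ^ 2)⁻¹)
    have h3 : C ((c ^ 2)⁻¹) * (C c * h) ^ 2 = h ^ 2 := by
      rw [mul_pow, ← C_pow, ← mul_assoc, ← C_mul, inv_mul_cancel₀ (pow_ne_zero 2 hc0), C_1, one_mul]
    rwa [h3] at h2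

end Hyper

/-! ### Limits of squares -/

section Closure
open MeasureTheory Polynomial ComplexConjugate Filter Topology

/-- The submultiplicative norm `∑ (1 + n) |p_n|`, which dominates both the supremum of `|p|` on
the circle and the Dirichlet energy. -/
noncomputable def wienerNorm (p : ℂ[X]) : ℝ := p.sum fun n a ↦ (1 + n) * ‖a‖

lemma wienerNorm_eq_sum_range (p : ℂ[X]) {N : ℕ} (hN : p.natDegree < N) :
    wienerNorm p = ∑ n ∈ Finset.range N, (1 + n) * ‖p.coeff n‖ :=
  p.sum_over_range' (f := fun n a ↦ (1 + n) * ‖a‖) (by simp) N hN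

lemma wienerNorm_nonneg (p : ℂ[X]) : 0 ≤ wienerNorm p :=
  Finset.sum_nonneg fun _ _ ↦ by positivity

lemma wienerNorm_add_le (p q : ℂ[X]) : wienerNorm (p + q) ≤ wienerNorm p + wienerNorm q := by
  set N := max p.natDegree q.natDegree + 1
  have h1 : p.natDegree < N := Nat.lt_succ_of_le (le_max_left _ _)
  have h2 : q.natDegree < N := Nat.lt_succ_of_le (le_max_right _ _)
  have h3 : (p + q).natDegree < N := Nat.lt_succ_of_le (natDegree_add_le p q)
  rw [wienerNorm_eq_sum_range _ h1, wienerNorm_eq_sum_range _ h2, wienerNorm_eq_sum_range _ h3,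
    ← Finset.sum_add_distrib]
  refine Finset.sum_le_sum fun n _ ↦ ?_
  rw [coeff_add, ← mul_add]
  gcongr
  exact norm_add_le _ _

lemma wienerNorm_sum_le {ι : Type*} (s : Finset ι) (f : ι → ℂ[X]) :
    wienerNorm (∑ i ∈ s, f i) ≤ ∑ i ∈ s, wienerNorm (f i) :=
  Finset.le_sum_of_subadditive wienerNorm (by simp [wienerNorm]) wienerNorm_add_le s f

lemma wienerNorm_monomial (n : ℕ) (a : ℂ) : wienerNorm (monomial n a) = (1 + n) * ‖a‖ :=
  sum_monomial_index _ _ (by simp)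

lemma wienerNorm_monomial_mul_le (n : ℕ) (a : ℂ) (q : ℂ[X]) :
    wienerNorm (monomial n a * q) ≤ (1 + n) * ‖a‖ * wienerNorm q := by
  conv_lhs => rw [q.as_sum_support, Finset.mul_sum]
  refine (wienerNorm_sum_le _ _).trans ?_
  rw [wienerNorm, sum_def, Finset.mul_sum]
  refine Finset.sum_le_sum fun j _ ↦ ?_
  rw [monomial_mul_monomial, wienerNorm_monomial, norm_mul]
  push_cast
  have : 0 ≤ ‖a‖ * ‖q.coeff j‖ * (n * j) := by positivity
  linarith

lemma wienerNorm_mul_le (p q : ℂ[X]) : wienerNorm (p * q) ≤ wienerNorm p * wienerNorm q := by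
  conv_lhs => rw [p.as_sum_support, Finset.sum_mul]
  refine (wienerNorm_sum_le _ _).trans ?_
  conv_rhs => rw [wienerNorm, sum_def, Finset.sum_mul]
  exact Finset.sum_le_sum fun j _ ↦ wienerNorm_monomial_mul_le _ _ _

lemma norm_eval_le_wienerNorm (p : ℂ[X]) {z : ℂ} (hz : ‖z‖ = 1) : ‖p.eval z‖ ≤ wienerNorm p := by
  rw [eval_eq_sum, wienerNorm, sum_def, sum_def]
  refine (norm_sum_le _ _).trans (Finset.sum_le_sum fun n _ ↦ ?_)
  rw [norm_mul, norm_pow, hz, one_pow, mul_one]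
  nlinarith [norm_nonneg (p.coeff n), (Nat.cast_nonneg n : (0:ℝ) ≤ n)]

/-- A polynomial that is a limit of squares of polynomials in the norm `wienerNorm`. -/
def IsSqLimit (p : ℂ[X]) : Prop :=
  ∃ h : ℕ → ℂ[X], Tendsto (fun N ↦ wienerNorm (h N ^ 2 - p)) atTop (𝓝 0)

lemma IsSqLimit.mul {p q : ℂ[X]} (hp : IsSqLimit p) (hq : IsSqLimit q) : IsSqLimit (p * q) := by
  obtain ⟨h, hh⟩ := hp
  obtain ⟨g, hg⟩ := hq
  refine ⟨fun N ↦ h N * g N, ?_⟩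
  have hlim := ((hh.mul hg).add (hh.mul_const (wienerNorm q))).add (hg.const_mul (wienerNorm p))
  simp only [mul_zero, zero_mul, add_zero] at hlim
  refine squeeze_zero (fun _ ↦ wienerNorm_nonneg _) (fun N ↦ ?_) hlim
  have e : (h N * g N) ^ 2 - p * q
      = (h N ^ 2 - p) * (g N ^ 2 - q) + (h N ^ 2 - p) * q + p * (g N ^ 2 - q) := by ring
  rw [e]
  exact (wienerNorm_add_le _ _).trans (add_le_add ((wienerNorm_add_le _ _).trans
    (add_le_add (wienerNorm_mul_le _ _) (wienerNorm_mul_le _ _))) (wienerNorm_mul_le _ _))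

lemma isSqLimit_sq (p : ℂ[X]) : IsSqLimit (p ^ 2) :=
  ⟨fun _ ↦ p, by simp [wienerNorm]⟩

lemma isSqLimit_C (c : ℂ) : IsSqLimit (C c) := by
  obtain ⟨a, rfl⟩ := IsAlgClosed.exists_pow_nat_eq c (n := 2) (by norm_num)
  rw [C_pow]; exact isSqLimit_sq _

lemma isSqLimit_of_tendsto {p : ℂ[X]} {f : ℕ → ℂ[X]} (hf : ∀ N, IsSqLimit (f N))
    (hlim : Tendsto (fun N ↦ wienerNorm (f N - p)) atTop (𝓝 0)) : IsSqLimit p := by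
  choose h hh using hf
  have h1 : ∀ N : ℕ, ∃ M, wienerNorm (h N M ^ 2 - f N) < 1 / ((N : ℝ) + 1) := fun N ↦
    ((hh N).eventually_lt_const (by positivity)).exists
  choose M hM using h1
  refine ⟨fun N ↦ h N (M N), ?_⟩
  have h2 := (tendsto_one_div_add_atTop_nhds_zero_nat (𝕜 := ℝ)).add hlim
  rw [add_zero] at h2
  refine squeeze_zero (fun _ ↦ wienerNorm_nonneg _) (fun N ↦ ?_) h2
  have e : h N (M N) ^ 2 - p = (h N (M N) ^ 2 - f N) + (f N - p) := by ring
  rw [e]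
  exact (wienerNorm_add_le _ _).trans (add_le_add (hM N).le le_rfl)

/-- The binomial coefficients of `√(1 + x)` are bounded by `1`. -/
lemma norm_choose_half_le (n : ℕ) : ‖Ring.choose (1 / 2 : ℂ) n‖ ≤ 1 := by
  induction n with
  | zero => simp
  | succ n ih =>
    have h := Ring.choose_smul_choose (1 / 2 : ℂ) (n := n + 1) (k := n) (by omega)
    rw [Nat.choose_succ_self_right, Nat.add_sub_cancel_left, Ring.choose_one_right,
      nsmul_eq_mul] at h
    have h1 := congrArg norm h
    rw [norm_mul, norm_mul, Complex.norm_natCast] at h1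
    have h2 : ‖(1 / 2 : ℂ) - n‖ ≤ n + 1 := by
      refine (norm_sub_le _ _).trans ?_
      rw [Complex.norm_natCast]; norm_num; linarith
    have h3 : ‖Ring.choose (1 / 2 : ℂ) n‖ * ‖(1 / 2 : ℂ) - n‖ ≤ 1 * (n + 1) :=
      mul_le_mul ih h2 (norm_nonneg _) zero_le_one
    rw [← h1] at h3
    push_cast at h3
    have hn : (0 : ℝ) < n + 1 := by positivity
    nlinarith

lemma sum_choose_half (n : ℕ) : ∑ ij ∈ Finset.HasAntidiagonal.antidiagonal n,
    Ring.choose (1 / 2 : ℂ) ij.1 * Ring.choose (1 / 2 : ℂ) ij.2 = ((Nat.choose 1 n : ℕ) : ℂ) := by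
  rw [← Ring.add_choose_eq n (Commute.all _ _)]
  norm_num
  have := Ring.choose_natCast (R := ℂ) 1 n
  rwa [Nat.cast_one] at this

/-- For `|b| < 1` the polynomial `1 + bX` is the limit of the squares of the partial sums of the
binomial series of `√(1 + bX)`. -/
lemma isSqLimit_one_add_of_norm_lt_one {b : ℂ} (hb : ‖b‖ < 1) : IsSqLimit (1 + C b * X) := by
  set h : ℕ → ℂ[X] := fun N ↦ ∑ n ∈ Finset.range N, monomial n (Ring.choose (1 / 2 : ℂ) n * b ^ n)
    with hdef
  have hcoeff : ∀ N n, (h N).coeff n = if n < N then Ring.choose (1 / 2 : ℂ) n * b ^ n else 0 := by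
    intro N n
    simp [hdef, coeff_monomial]
  have hle : ∀ N n, ‖(h N).coeff n‖ ≤ ‖b‖ ^ n := by
    intro N n
    rw [hcoeff]
    split_ifs
    · rw [norm_mul, norm_pow]
      exact mul_le_of_le_one_left (by positivity) (norm_choose_half_le n)
    · simp
  have hdeg : ∀ N, (h N).natDegree ≤ N := by
    intro N
    rw [natDegree_le_iff_coeff_eq_zero]
    intro n hn
    rw [hcoeff, if_neg (by omega)]
  have hsq : ∀ N n, ‖(h N ^ 2).coeff n‖ ≤ (n + 1) * ‖b‖ ^ n := by
    intro N n
    rw [pow_two, coeff_mul]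
    refine (norm_sum_le _ _).trans ?_
    have : ∀ ij ∈ Finset.HasAntidiagonal.antidiagonal n, ‖(h N).coeff ij.1 * (h N).coeff ij.2‖
        ≤ ‖b‖ ^ n := by
      intro ij hij
      rw [← Finset.HasAntidiagonal.mem_antidiagonal.mp hij, pow_add, norm_mul]
      exact mul_le_mul (hle _ _) (hle _ _) (norm_nonneg _) (by positivity)
    refine (Finset.sum_le_card_nsmul _ _ _ this).trans (le_of_eq ?_)
    simp
  have hsmall : ∀ N n, n < N → (h N ^ 2).coeff n = (1 + C b * X : ℂ[X]).coeff n := by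
    intro N n hn
    have : (h N ^ 2).coeff n = ∑ ij ∈ Finset.HasAntidiagonal.antidiagonal n,
        Ring.choose (1 / 2 : ℂ) ij.1 * Ring.choose (1 / 2 : ℂ) ij.2 * b ^ n := by
      rw [pow_two, coeff_mul]
      refine Finset.sum_congr rfl fun ij hij ↦ ?_
      have := Finset.HasAntidiagonal.mem_antidiagonal.mp hij
      rw [hcoeff, hcoeff, if_pos (by omega), if_pos (by omega), ← this, pow_add]
      ring
    rw [this, ← Finset.sum_mul, sum_choose_half]
    rcases n with _ | _ | n
    · simp
    · simp [coeff_one]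
    · simp [coeff_one, Nat.choose_eq_zero_of_lt]
  refine ⟨h, ?_⟩
  have hsum : Summable fun n : ℕ ↦ ((n : ℝ) + 1) ^ 2 * ‖b‖ ^ n := by
    have h0 := summable_pow_mul_geometric_of_norm_lt_one 0 (r := ‖b‖) (by simpa using hb)
    have h1 := summable_pow_mul_geometric_of_norm_lt_one 1 (r := ‖b‖) (by simpa using hb)
    have h2 := summable_pow_mul_geometric_of_norm_lt_one 2 (r := ‖b‖) (by simpa using hb)
    refine ((h2.add (h1.mul_left 2)).add h0).congr fun n ↦ ?_
    ring
  have htail := tendsto_sum_nat_add fun n : ℕ ↦ ((n : ℝ) + 1) ^ 2 * ‖b‖ ^ n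
  refine squeeze_zero' (Eventually.of_forall fun _ ↦ wienerNorm_nonneg _) ?_ htail
  filter_upwards [eventually_ge_atTop 2] with N hN
  set D := h N ^ 2 - (1 + C b * X) with hD
  have hDdeg : D.natDegree < N + (N + 1) := by
    refine Nat.lt_of_le_of_lt ((natDegree_sub_le _ _).trans
      (max_le (natDegree_pow_le_of_le 2 (hdeg N)) (?_ : _ ≤ 2 * N))) (by omega)
    refine (natDegree_add_le _ _).trans (max_le (by simp) ((natDegree_C_mul_le _ _).trans ?_))
    rw [natDegree_X]; omega
  rw [wienerNorm_eq_sum_range D hDdeg, Finset.sum_range_add]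
  have z1 : ∑ n ∈ Finset.range N, (1 + (n : ℝ)) * ‖D.coeff n‖ = 0 := by
    refine Finset.sum_eq_zero fun n hn ↦ ?_
    rw [hD, coeff_sub, hsmall N n (Finset.mem_range.mp hn), sub_self, norm_zero, mul_zero]
  rw [z1, zero_add]
  refine le_trans (Finset.sum_le_sum fun n _ ↦ ?_)
    (((summable_nat_add_iff N).mpr hsum).sum_le_tsum (Finset.range (N + 1))
      fun _ _ ↦ by positivity)
  have z2 : (1 + C b * X : ℂ[X]).coeff (N + n) = 0 := by
    have h1 : N + n ≠ 0 := by omega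
    have h2 : N + n ≠ 1 := by omega
    rw [coeff_add, coeff_C_mul, coeff_one, coeff_X, if_neg h1, if_neg (Ne.symm h2)]; simp
  rw [hD, coeff_sub, z2, sub_zero]
  calc (1 + ((N + n : ℕ) : ℝ)) * ‖(h N ^ 2).coeff (N + n)‖
      ≤ (1 + ((N + n : ℕ) : ℝ)) * (((N + n : ℕ) + 1) * ‖b‖ ^ (N + n)) := by
        gcongr; exact hsq _ _
    _ = _ := by rw [add_comm N n]; ring

lemma isSqLimit_one_add {b : ℂ} (hb : ‖b‖ ≤ 1) : IsSqLimit (1 + C b * X) := by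
  have ht : Tendsto (fun N : ℕ ↦ 2 * (1 / ((N : ℝ) + 1))) atTop (𝓝 0) := by
    simpa using (tendsto_one_div_add_atTop_nhds_zero_nat (𝕜 := ℝ)).const_mul 2
  refine isSqLimit_of_tendsto (f := fun N ↦ 1 + C (((1 - 1 / ((N : ℝ) + 1) : ℝ) : ℂ) * b) * X)
    (fun N ↦ isSqLimit_one_add_of_norm_lt_one ?_)
    (squeeze_zero (fun _ ↦ wienerNorm_nonneg _) (fun N ↦ ?_) ht)
  · have h1 : (0:ℝ) < 1 / ((N : ℝ) + 1) := by positivity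
    have h2 : 1 / ((N : ℝ) + 1) ≤ 1 := by
      rw [div_le_one (by positivity)]; linarith [(Nat.cast_nonneg N : (0:ℝ) ≤ N)]
    rw [norm_mul, Complex.norm_real, Real.norm_eq_abs, abs_of_nonneg (by linarith)]
    nlinarith [norm_nonneg b]
  · have e : (1 + C (((1 - 1 / ((N : ℝ) + 1) : ℝ) : ℂ) * b) * X) - (1 + C b * X)
        = monomial 1 (-((1 / ((N : ℝ) + 1) : ℝ) : ℂ) * b) := by
      rw [← C_mul_X_eq_monomial, add_sub_add_left_eq_sub, ← sub_mul, ← C_sub]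
      congr 2; push_cast; ring
    have h1 : (0:ℝ) < 1 / ((N : ℝ) + 1) := by positivity
    rw [e, wienerNorm_monomial, norm_mul, norm_neg, Complex.norm_real, Real.norm_eq_abs,
      abs_of_pos h1]
    push_cast
    nlinarith [norm_nonneg b]

end Closure

/-! ### The contractive inequality on the circle -/

section OneVariable
open MeasureTheory Polynomial ComplexConjugate Filter Topology

/-- The quadratic functional in `IsHypercontractive` is continuous for `wienerNorm`. -/
lemma abs_weight_sub_le {c : ℝ} (hc0 : 0 ≤ c) (hc : c ≤ 1) (p q : ℂ[X]) :
    |(hardySq p + c * dirichletEnergy p) - (hardySq q + c * dirichletEnergy q)|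
      ≤ wienerNorm (p - q) * (wienerNorm p + wienerNorm q) := by
  set N := max p.natDegree q.natDegree + 1
  have h1 : p.natDegree < N := Nat.lt_succ_of_le (le_max_left _ _)
  have h2 : q.natDegree < N := Nat.lt_succ_of_le (le_max_right _ _)
  have h3 : (p - q).natDegree < N := Nat.lt_succ_of_le (natDegree_sub_le p q)
  have hle : ∀ (f : ℂ[X]), f.natDegree < N → ∀ n ∈ Finset.range N, ‖f.coeff n‖ ≤ wienerNorm f := by
    intro f hf n hn
    rw [wienerNorm_eq_sum_range f hf]
    refine le_trans ?_ (Finset.single_le_sum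
      (f := fun n : ℕ ↦ (1 + (n : ℝ)) * ‖f.coeff n‖) (fun _ _ ↦ by positivity) hn)
    nlinarith [norm_nonneg (f.coeff n), (Nat.cast_nonneg n : (0:ℝ) ≤ n)]
  have e : (hardySq p + c * dirichletEnergy p) - (hardySq q + c * dirichletEnergy q)
      = ∑ n ∈ Finset.range N, (1 + c * n) * (‖p.coeff n‖ ^ 2 - ‖q.coeff n‖ ^ 2) := by
    rw [hardySq_eq_sum_range p h1, hardySq_eq_sum_range q h2, dirichletEnergy_eq_sum_range p h1,
      dirichletEnergy_eq_sum_range q h2, Finset.mul_sum, Finset.mul_sum,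
      ← Finset.sum_add_distrib, ← Finset.sum_add_distrib, ← Finset.sum_sub_distrib]
    exact Finset.sum_congr rfl fun n _ ↦ by ring
  rw [e, wienerNorm_eq_sum_range _ h3, Finset.sum_mul]
  refine (Finset.abs_sum_le_sum_abs _ _).trans (Finset.sum_le_sum fun n hn ↦ ?_)
  have a1 := hle p h1 n hn
  have a2 := hle q h2 n hn
  have a3 : |‖p.coeff n‖ - ‖q.coeff n‖| ≤ ‖(p - q).coeff n‖ := by
    rw [coeff_sub]; exact abs_norm_sub_norm_le _ _
  have hn0 : (0:ℝ) ≤ n := Nat.cast_nonneg n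
  have w1 := wienerNorm_nonneg p
  have w2 := wienerNorm_nonneg q
  rw [sq_sub_sq, abs_mul, abs_mul, abs_of_nonneg (by positivity : 0 ≤ 1 + c * (n:ℝ)),
    abs_of_nonneg (by positivity : 0 ≤ ‖p.coeff n‖ + ‖q.coeff n‖)]
  calc (1 + c * (n:ℝ)) * ((‖p.coeff n‖ + ‖q.coeff n‖) * |‖p.coeff n‖ - ‖q.coeff n‖|)
      ≤ (1 + 1 * (n:ℝ)) * ((wienerNorm p + wienerNorm q) * ‖(p - q).coeff n‖) := by gcongr
    _ = _ := by ring

lemma IsSqLimit.isHypercontractive {δ : ℝ} (hδ : 0 ≤ δ) (hδ2 : δ ≤ 1 / 2) {p : ℂ[X]}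
    (hp : IsSqLimit p) : IsHypercontractive δ p := by
  obtain ⟨h, hh⟩ := hp
  have hc0 : 0 ≤ δ * (1 + 2 * δ) := by positivity
  have hc1 : δ * (1 + 2 * δ) ≤ 1 := by nlinarith
  have hbd : ∀ N, wienerNorm (h N ^ 2) ≤ wienerNorm (h N ^ 2 - p) + wienerNorm p := fun N ↦ by
    have := wienerNorm_add_le (h N ^ 2 - p) p
    rwa [sub_add_cancel] at this
  have hR : Tendsto (fun N ↦ hardySq (h N ^ 2) + δ * (1 + 2 * δ) * dirichletEnergy (h N ^ 2)) atTop
      (𝓝 (hardySq p + δ * (1 + 2 * δ) * dirichletEnergy p)) := by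
    rw [tendsto_iff_norm_sub_tendsto_zero]
    have hlim : Tendsto (fun N ↦ wienerNorm (h N ^ 2 - p) *
        (wienerNorm (h N ^ 2 - p) + wienerNorm p + wienerNorm p)) atTop (𝓝 0) := by
      simpa using hh.mul ((hh.add_const (wienerNorm p)).add_const (wienerNorm p))
    refine squeeze_zero (fun _ ↦ norm_nonneg _) (fun N ↦ ?_) hlim
    rw [Real.norm_eq_abs]
    refine (abs_weight_sub_le hc0 hc1 _ _).trans ?_
    have := wienerNorm_nonneg (h N ^ 2 - p)
    gcongr
    exact hbd N
  have hL : Tendsto (fun N ↦ ∫ x, ‖(h N ^ 2).eval (circlePt x)‖ ^ (2 + 2 * δ)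
      ∂AddCircle.haarAddCircle) atTop
      (𝓝 (∫ x, ‖p.eval (circlePt x)‖ ^ (2 + 2 * δ) ∂AddCircle.haarAddCircle)) := by
    refine tendsto_integral_filter_of_dominated_convergence
      (fun _ ↦ (1 + wienerNorm p) ^ (2 + 2 * δ)) ?_ ?_ (integrable_const _) ?_
    · exact Eventually.of_forall fun N ↦
        (((continuous_eval_circlePt _).norm).rpow_const
          fun x ↦ Or.inr (by positivity)).aestronglyMeasurable
    · filter_upwards [hh.eventually_le_const (show (0:ℝ) < 1 by norm_num)] with N hN
      refine Eventually.of_forall fun x ↦ ?_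
      rw [Real.norm_of_nonneg (by positivity)]
      gcongr
      exact (norm_eval_le_wienerNorm _ (norm_circlePt x)).trans ((hbd N).trans (by linarith))
    · refine Eventually.of_forall fun x ↦ ?_
      have h1 : Tendsto (fun N ↦ (h N ^ 2).eval (circlePt x)) atTop (𝓝 (p.eval (circlePt x))) := by
        rw [tendsto_iff_norm_sub_tendsto_zero]
        refine squeeze_zero (fun _ ↦ norm_nonneg _) (fun N ↦ ?_) hh
        rw [← eval_sub]
        exact norm_eval_le_wienerNorm _ (norm_circlePt x)
      exact h1.norm.rpow_const (Or.inr (by positivity))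
  exact le_of_tendsto_of_tendsto' hL (hR.rpow_const (Or.inr (by positivity)))
    fun N ↦ isHypercontractive_sq hδ hδ2 (h N)

/-- Reflecting a root in the unit circle does not change the modulus on the circle. -/
lemma norm_sub_eq_norm_one_sub_conj_mul (a : ℂ) {z : ℂ} (hz : ‖z‖ = 1) :
    ‖z - a‖ = ‖1 - conj a * z‖ := by
  have h : z * conj z = 1 := by rw [Complex.mul_conj, Complex.normSq_eq_norm_sq, hz]; simp
  have h2 : z - a = z * conj (1 - conj a * z) := by
    simp only [map_sub, map_one, map_mul, Complex.conj_conj]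
    linear_combination a * h
  rw [h2, norm_mul, hz, one_mul, Complex.norm_conj]

/-- Reflecting a root from inside the unit disk to the outside decreases the energy. -/
lemma dirichletEnergy_reflect_le (h : ℂ[X]) {a : ℂ} (ha : ‖a‖ ≤ 1) :
    dirichletEnergy ((1 - C (conj a) * X) * h) ≤ dirichletEnergy ((X - C a) * h) := by
  have e1 : (1 - C (conj a) * X) * h = h + C (-conj a) * (X * h) := by
    rw [C_neg]; ring
  have e2 : (X - C a) * h = C (-a) * h + X * h := by rw [C_neg]; ring
  have e3 : X * derivative (C (-a) * h) = C (-a) * (X * derivative h) := by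
    rw [derivative_C_mul]; ring
  rw [e1, e2, dirichletEnergy_add, dirichletEnergy_add, e3, circleInner_C_mul_right,
    circleInner_C_mul_left, dirichletEnergy_C_mul, dirichletEnergy_C_mul, dirichletEnergy_X_mul,
    norm_neg, norm_neg, Complex.norm_conj, map_neg, Complex.conj_conj]
  have h1 := hardySq_nonneg h
  have h2 : ‖a‖ ^ 2 ≤ 1 := pow_le_one₀ (norm_nonneg a) ha
  nlinarith

/-- Every polynomial has the same modulus on the circle as a limit of squares (its outer part)
of smaller Dirichlet energy. -/
lemma exists_isSqLimit_of_roots (s : Multiset ℂ) : ∀ u : ℂ[X], IsSqLimit u →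
    ∃ g : ℂ[X], IsSqLimit g ∧
      (∀ z : ℂ, ‖z‖ = 1 → ‖g.eval z‖ = ‖(u * (s.map fun a ↦ X - C a).prod).eval z‖) ∧
      dirichletEnergy g ≤ dirichletEnergy (u * (s.map fun a ↦ X - C a).prod) := by
  induction s using Multiset.induction_on with
  | empty => intro u hu; exact ⟨u, hu, by simp⟩
  | cons a s ih =>
    intro u hu
    set p := (s.map fun a ↦ X - C a).prod with hp
    rw [Multiset.map_cons, Multiset.prod_cons, ← hp]
    rcases le_total ‖a‖ 1 with ha | ha
    · have h1 : IsSqLimit (1 - C (conj a) * X) := by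
        have := isSqLimit_one_add (b := -conj a) (by rwa [norm_neg, Complex.norm_conj])
        rwa [C_neg, neg_mul, ← sub_eq_add_neg] at this
      obtain ⟨g, hg, hn, he⟩ := ih (u * (1 - C (conj a) * X)) (hu.mul h1)
      refine ⟨g, hg, fun z hz ↦ ?_, he.trans ?_⟩
      · rw [hn z hz]
        simp only [eval_mul, eval_sub, eval_X, eval_C, eval_one, norm_mul,
          norm_sub_eq_norm_one_sub_conj_mul a hz]
        ring
      · have := dirichletEnergy_reflect_le (u * p) ha
        rwa [show (1 - C (conj a) * X) * (u * p) = u * (1 - C (conj a) * X) * p by ring,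
          show (X - C a) * (u * p) = u * ((X - C a) * p) by ring] at this
    · have ha0 : a ≠ 0 := by
        rintro rfl; rw [norm_zero] at ha; linarith
      have h1 : IsSqLimit (X - C a) := by
        have h2 := (isSqLimit_C (-a)).mul (isSqLimit_one_add (b := -a⁻¹)
          (by rw [norm_neg, norm_inv]; exact inv_le_one_of_one_le₀ ha))
        convert h2 using 1
        have h3 : C a * C a⁻¹ = 1 := by rw [← C_mul, mul_inv_cancel₀ ha0, C_1]
        simp only [C_neg]
        linear_combination (-X) * h3
      obtain ⟨g, hg, hn, he⟩ := ih (u * (X - C a)) (hu.mul h1)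
      rw [← mul_assoc]
      exact ⟨g, hg, hn, he⟩

/-- The contractive inequality on the circle: `∫ |f|^{2+2δ} ≤ (∑ (1 + δ + 2δ²)^n |f_n|²)^{1+δ}`. -/
theorem integral_norm_rpow_le {δ : ℝ} (hδ : 0 ≤ δ) (hδ2 : δ ≤ 1 / 2) (f : ℂ[X]) :
    ∫ x, ‖f.eval (circlePt x)‖ ^ (2 + 2 * δ) ∂AddCircle.haarAddCircle
      ≤ (f.sum fun n a ↦ (1 + δ + 2 * δ ^ 2) ^ n * ‖a‖ ^ 2) ^ (1 + δ) := by
  have hf : f = C f.leadingCoeff * (f.roots.map fun a ↦ X - C a).prod :=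
    (C_leadingCoeff_mul_prod_multiset_X_sub_C IsAlgClosed.card_roots_eq_natDegree).symm
  obtain ⟨g, hg, hn, he⟩ := exists_isSqLimit_of_roots f.roots _ (isSqLimit_C f.leadingCoeff)
  rw [← hf] at hn he
  have h1 := hg.isHypercontractive hδ hδ2
  unfold IsHypercontractive at h1
  simp_rw [fun x ↦ hn (circlePt x) (norm_circlePt x)] at h1
  have h2 : hardySq g = hardySq f := by
    rw [← integral_norm_sq_eval, ← integral_norm_sq_eval]
    simp_rw [fun x ↦ hn (circlePt x) (norm_circlePt x)]
  refine h1.trans (Real.rpow_le_rpow ?_ ?_ (by linarith))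
  · have := hardySq_nonneg g
    have := dirichletEnergy_nonneg g
    positivity
  · rw [h2]
    have hc0 : 0 ≤ δ * (1 + 2 * δ) := by positivity
    refine (add_le_add_right (mul_le_mul_of_nonneg_left he hc0) _).trans ?_
    rw [hardySq, dirichletEnergy, sum_def, sum_def, sum_def, Finset.mul_sum,
      ← Finset.sum_add_distrib]
    refine Finset.sum_le_sum fun n _ ↦ ?_
    have hb := one_add_mul_le_pow (show (-2:ℝ) ≤ δ * (1 + 2 * δ) by linarith) n
    calc ‖f.coeff n‖ ^ 2 + δ * (1 + 2 * δ) * (n * ‖f.coeff n‖ ^ 2)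
        = (1 + n * (δ * (1 + 2 * δ))) * ‖f.coeff n‖ ^ 2 := by ring
      _ ≤ (1 + δ * (1 + 2 * δ)) ^ n * ‖f.coeff n‖ ^ 2 := by gcongr
      _ = _ := by congr 2; ring

end OneVariable

/-! ### Tensorization to the torus -/

section Torus
open MeasureTheory ComplexConjugate

/-- The point of the torus in `ℂⁿ` with the given coordinates in `ℝ/ℤ`. -/
noncomputable def torusPt {n : ℕ} (x : Fin n → AddCircle (1 : ℝ)) : Fin n → ℂ :=
  fun i ↦ circlePt (x i)

/-- The normalised Haar measure of the `n`-dimensional torus. -/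
noncomputable def torusMeasure (n : ℕ) : Measure (Fin n → AddCircle (1 : ℝ)) :=
  Measure.pi fun _ ↦ AddCircle.haarAddCircle

instance (n : ℕ) : IsProbabilityMeasure (torusMeasure n) := by
  unfold torusMeasure; infer_instance

@[fun_prop]
lemma continuous_torusPt {n : ℕ} : Continuous (torusPt (n := n)) :=
  continuous_pi fun i ↦ continuous_circlePt.comp (continuous_apply i)

@[fun_prop]
lemma continuous_eval_torusPt {n : ℕ} (P : MvPolynomial (Fin n) ℂ) :
    Continuous fun x ↦ MvPolynomial.eval (torusPt x) P :=
  (MvPolynomial.continuous_eval P).comp continuous_torusPt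

lemma torusPt_cons {n : ℕ} (x : AddCircle (1 : ℝ)) (y : Fin n → AddCircle (1 : ℝ)) :
    torusPt (Fin.cons x y : Fin (n + 1) → AddCircle (1 : ℝ))
      = Fin.cons (circlePt x) (torusPt y) := by
  ext i
  refine Fin.cases ?_ (fun j ↦ ?_) i <;> simp [torusPt]

lemma lintegral_torus_succ {n : ℕ} {f : (Fin (n + 1) → AddCircle (1 : ℝ)) → ℝ≥0∞}
    (hf : Continuous f) :
    ∫⁻ x, f x ∂torusMeasure (n + 1)
      = ∫⁻ y, ∫⁻ x, f (Fin.cons x y) ∂AddCircle.haarAddCircle ∂torusMeasure n := by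
  have h := measurePreserving_piFinSuccAbove
    (fun _ : Fin (n + 1) ↦ (AddCircle.haarAddCircle : Measure (AddCircle (1 : ℝ)))) 0
  have h2 := h.symm.lintegral_comp_emb (MeasurableEquiv.measurableEmbedding _) f
  rw [torusMeasure, ← h2]
  have e : ∀ p, f ((MeasurableEquiv.piFinSuccAbove
      (fun _ : Fin (n + 1) ↦ AddCircle (1 : ℝ)) 0).symm p) = f (Fin.cons p.1 p.2) := by
    intro p; simp [MeasurableEquiv.piFinSuccAbove]; rfl
  simp_rw [e]
  rw [lintegral_prod_symm]
  · rfl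
  · refine Measurable.aemeasurable (Continuous.measurable ?_)
    refine hf.comp (continuous_pi fun i ↦ ?_)
    refine Fin.cases ?_ (fun j ↦ ?_) i
    · simpa using continuous_fst
    · simpa [Function.comp_def] using (continuous_apply j).comp continuous_snd

/-- A monomial exponent in `n + 1` variables is an exponent of the first variable together with an
exponent in the others. -/
noncomputable def finsuppConsEquiv (n : ℕ) : ℕ × (Fin n →₀ ℕ) ≃ (Fin (n + 1) →₀ ℕ) where
  toFun p := p.2.cons p.1
  invFun α := (α 0, α.tail)
  left_inv p := by simp
  right_inv α := by simp

/-- The weighted `ℓ²` norm `∑ ρ^|α| |c_α|²` of the coefficients of a polynomial. -/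
noncomputable def coeffWeight (ρ : ℝ≥0∞) {n : ℕ} (P : MvPolynomial (Fin n) ℂ) : ℝ≥0∞ :=
  ∑' α : Fin n →₀ ℕ, ρ ^ α.degree * ‖P.coeff α‖ₑ ^ 2

lemma coeffWeight_succ (ρ : ℝ≥0∞) {n : ℕ} (P : MvPolynomial (Fin (n + 1)) ℂ) {N : ℕ}
    (hN : (MvPolynomial.finSuccEquiv ℂ n P).natDegree < N) :
    coeffWeight ρ P = ∑ j ∈ Finset.range N,
      ρ ^ j * coeffWeight ρ ((MvPolynomial.finSuccEquiv ℂ n P).coeff j) := by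
  rw [coeffWeight, ← (finsuppConsEquiv n).tsum_eq, ENNReal.tsum_prod',
    tsum_eq_sum (s := Finset.range N)]
  · refine Finset.sum_congr rfl fun j _ ↦ ?_
    rw [coeffWeight, ← ENNReal.tsum_mul_left]
    refine tsum_congr fun α ↦ ?_
    rw [MvPolynomial.finSuccEquiv_coeff_coeff, ← mul_assoc, ← pow_add]
    congr 2
    simp [finsuppConsEquiv, Finsupp.degree_eq_sum, Fin.sum_univ_succ]
  · intro j hj
    have h0 : (MvPolynomial.finSuccEquiv ℂ n P).coeff j = 0 :=
      Polynomial.coeff_eq_zero_of_natDegree_lt (by simp at hj; omega)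
    rw [ENNReal.tsum_eq_zero]
    intro α
    have : P.coeff (α.cons j) = 0 := by
      rw [← MvPolynomial.finSuccEquiv_coeff_coeff, h0, MvPolynomial.coeff_zero]
    simp [finsuppConsEquiv, this]

/-- Minkowski's inequality for finite sums. -/
lemma lintegral_sum_rpow_le {α ι : Type*} [MeasurableSpace α] {μ : Measure α} {p : ℝ} (hp : 1 ≤ p)
    (s : Finset ι) {f : ι → α → ℝ≥0∞} (hf : ∀ i, Measurable (f i)) :
    ∫⁻ x, (∑ i ∈ s, f i x) ^ p ∂μ ≤ (∑ i ∈ s, (∫⁻ x, f i x ^ p ∂μ) ^ (1 / p)) ^ p := by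
  classical
  have hp0 : 0 < p := by linarith
  have key : (∫⁻ x, (∑ i ∈ s, f i x) ^ p ∂μ) ^ (1 / p)
      ≤ ∑ i ∈ s, (∫⁻ x, f i x ^ p ∂μ) ^ (1 / p) := by
    induction s using Finset.induction_on with
    | empty => simp [hp0, ENNReal.zero_rpow_of_pos, inv_pos.mpr hp0]
    | insert a s ha ih =>
      simp only [Finset.sum_insert ha]
      exact (ENNReal.lintegral_Lp_add_le (hf a).aemeasurable
        (Finset.measurable_fun_sum s fun i _ ↦ hf i).aemeasurable hp).trans (add_le_add le_rfl ih)
  rw [one_div, ENNReal.rpow_inv_le_iff hp0] at key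
  simpa only [one_div] using key

lemma enorm_rpow_eq_ofReal (z : ℂ) {p : ℝ} (hp : 0 ≤ p) :
    ‖z‖ₑ ^ p = ENNReal.ofReal (‖z‖ ^ p) := by
  rw [← ofReal_norm, ENNReal.ofReal_rpow_of_nonneg (norm_nonneg _) hp]

/-- The one-variable inequality, in the form used for tensorization. -/
lemma lintegral_circle_rpow_le {δ : ℝ} (hδ : 0 ≤ δ) (hδ2 : δ ≤ 1 / 2) (f : Polynomial ℂ) {N : ℕ}
    (hN : f.natDegree < N) :
    ∫⁻ x, ‖f.eval (circlePt x)‖ₑ ^ (2 + 2 * δ) ∂AddCircle.haarAddCircle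
      ≤ (∑ j ∈ Finset.range N,
          ENNReal.ofReal (1 + δ + 2 * δ ^ 2) ^ j * ‖f.coeff j‖ₑ ^ 2) ^ (1 + δ) := by
  have h := integral_norm_rpow_le hδ hδ2 f
  rw [f.sum_over_range' (f := fun n a ↦ (1 + δ + 2 * δ ^ 2) ^ n * ‖a‖ ^ 2) (by simp) N hN] at h
  simp_rw [fun z ↦ enorm_rpow_eq_ofReal z (show 0 ≤ 2 + 2 * δ by positivity)]
  rw [← ofReal_integral_eq_lintegral_ofReal]
  · refine (ENNReal.ofReal_le_ofReal h).trans (le_of_eq ?_)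
    rw [← ENNReal.ofReal_rpow_of_nonneg (Finset.sum_nonneg fun _ _ ↦ by positivity) (by positivity),
      ENNReal.ofReal_sum_of_nonneg fun _ _ ↦ by positivity]
    congr 1
    refine Finset.sum_congr rfl fun j _ ↦ ?_
    rw [ENNReal.ofReal_mul (by positivity), ENNReal.ofReal_pow (by positivity),
      ENNReal.ofReal_pow (norm_nonneg _), ofReal_norm]
  · exact ((continuous_eval_circlePt f).norm.rpow_const
      fun x ↦ Or.inr (by positivity)).integrable_haarAddCircle
  · exact Filter.Eventually.of_forall fun x ↦ by positivity

lemma lintegral_circle_sq (f : Polynomial ℂ) {N : ℕ} (hN : f.natDegree < N) :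
    ∫⁻ x, ‖f.eval (circlePt x)‖ₑ ^ 2 ∂AddCircle.haarAddCircle
      = ∑ j ∈ Finset.range N, ‖f.coeff j‖ₑ ^ 2 := by
  have h := integral_norm_sq_eval f
  rw [hardySq_eq_sum_range f hN] at h
  have e : ∀ z : ℂ, ‖z‖ₑ ^ 2 = ENNReal.ofReal (‖z‖ ^ 2) := fun z ↦ by
    rw [ENNReal.ofReal_pow (norm_nonneg _), ofReal_norm]
  simp_rw [e]
  rw [← ofReal_integral_eq_lintegral_ofReal, h,
    ENNReal.ofReal_sum_of_nonneg fun _ _ ↦ by positivity]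
  · exact ((continuous_eval_circlePt f).norm.pow 2).integrable_haarAddCircle
  · exact Filter.Eventually.of_forall fun x ↦ by positivity

lemma eval_torusPt_cons {n : ℕ} (P : MvPolynomial (Fin (n + 1)) ℂ) (x : AddCircle (1 : ℝ))
    (y : Fin n → AddCircle (1 : ℝ)) :
    MvPolynomial.eval (torusPt (Fin.cons x y : Fin (n + 1) → AddCircle (1 : ℝ))) P
      = ((MvPolynomial.finSuccEquiv ℂ n P).map (MvPolynomial.eval (torusPt y))).eval
        (circlePt x) := by
  rw [torusPt_cons, ← MvPolynomial.eval_eq_eval_mv_eval']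

/-- Parseval's identity on the torus. -/
lemma lintegral_torus_sq {n : ℕ} (P : MvPolynomial (Fin n) ℂ) :
    ∫⁻ x, ‖MvPolynomial.eval (torusPt x) P‖ₑ ^ 2 ∂torusMeasure n = coeffWeight 1 P := by
  induction n with
  | zero =>
    obtain ⟨c, rfl⟩ := MvPolynomial.C_surjective (Fin 0) P
    simp only [MvPolynomial.eval_C, lintegral_const, measure_univ, mul_one, coeffWeight]
    rw [tsum_eq_single 0 (fun b hb ↦ (hb (Subsingleton.elim _ _)).elim)]
    simp
  | succ n ih =>
    rw [lintegral_torus_succ (by fun_prop)]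
    set F := MvPolynomial.finSuccEquiv ℂ n P with hF
    have h1 : ∀ y, ∫⁻ x, ‖MvPolynomial.eval (torusPt (Fin.cons x y : Fin (n + 1) → _)) P‖ₑ ^ 2
        ∂AddCircle.haarAddCircle = ∑ j ∈ Finset.range (F.natDegree + 1),
          ‖MvPolynomial.eval (torusPt y) (F.coeff j)‖ₑ ^ 2 := by
      intro y
      simp_rw [eval_torusPt_cons]
      rw [lintegral_circle_sq _ (Nat.lt_succ_of_le Polynomial.natDegree_map_le)]
      simp [hF]
    simp_rw [h1]
    rw [lintegral_finsetSum _ (fun j _ ↦ Continuous.measurable (by fun_prop)),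
      coeffWeight_succ 1 P (Nat.lt_succ_self _)]
    simp [ih, hF]

/-- The contractive inequality on the torus, by Minkowski's inequality and induction on the number
of variables. -/
theorem lintegral_torus_rpow_le {δ : ℝ} (hδ : 0 ≤ δ) (hδ2 : δ ≤ 1 / 2) {n : ℕ}
    (P : MvPolynomial (Fin n) ℂ) :
    ∫⁻ x, ‖MvPolynomial.eval (torusPt x) P‖ₑ ^ (2 + 2 * δ) ∂torusMeasure n
      ≤ coeffWeight (ENNReal.ofReal (1 + δ + 2 * δ ^ 2)) P ^ (1 + δ) := by
  set ρ := ENNReal.ofReal (1 + δ + 2 * δ ^ 2) with hρ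
  have hq : (2 : ℝ) + 2 * δ = ((2 : ℕ) : ℝ) * (1 + δ) := by push_cast; ring
  have hδ1 : 0 < 1 + δ := by linarith
  induction n with
  | zero =>
    obtain ⟨c, rfl⟩ := MvPolynomial.C_surjective (Fin 0) P
    simp only [MvPolynomial.eval_C, lintegral_const, measure_univ, mul_one, coeffWeight]
    rw [tsum_eq_single 0 (fun b hb ↦ (hb (Subsingleton.elim _ _)).elim), hq, ENNReal.rpow_mul,
      ENNReal.rpow_natCast]
    simp
  | succ n ih =>
    rw [lintegral_torus_succ (by fun_prop)]
    set F := MvPolynomial.finSuccEquiv ℂ n P with hF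
    have h1 : ∀ y, ∫⁻ x, ‖MvPolynomial.eval (torusPt (Fin.cons x y : Fin (n + 1) → _)) P‖ₑ
        ^ (2 + 2 * δ) ∂AddCircle.haarAddCircle ≤ (∑ j ∈ Finset.range (F.natDegree + 1),
          ρ ^ j * ‖MvPolynomial.eval (torusPt y) (F.coeff j)‖ₑ ^ 2) ^ (1 + δ) := by
      intro y
      simp_rw [eval_torusPt_cons]
      refine (lintegral_circle_rpow_le hδ hδ2 _
        (Nat.lt_succ_of_le Polynomial.natDegree_map_le)).trans (le_of_eq ?_)
      simp [hF, hρ]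
    refine (lintegral_mono h1).trans ((lintegral_sum_rpow_le (by linarith) _ fun j ↦
      Continuous.measurable ?_).trans ?_)
    · exact (ENNReal.continuous_const_mul (by simp [hρ])).comp (by fun_prop)
    · rw [coeffWeight_succ ρ P (Nat.lt_succ_self _)]
      refine ENNReal.rpow_le_rpow (Finset.sum_le_sum fun j _ ↦ ?_) hδ1.le
      rw [one_div, ENNReal.rpow_inv_le_iff hδ1, ENNReal.mul_rpow_of_nonneg _ _ hδ1.le]
      simp_rw [ENNReal.mul_rpow_of_nonneg _ _ hδ1.le]
      rw [lintegral_const_mul _ (Continuous.measurable (by fun_prop))]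
      gcongr
      refine le_trans (le_of_eq ?_) (ih (F.coeff j))
      congr 1; ext y
      rw [hq, ENNReal.rpow_mul, ENNReal.rpow_natCast]

end Torus

/-! ### Comparison of moments of homogeneous polynomials -/

section Moments
open MeasureTheory

lemma coeffWeight_of_isHomogeneous {n d : ℕ} {P : MvPolynomial (Fin n) ℂ} (hP : P.IsHomogeneous d)
    (ρ : ℝ≥0∞) : coeffWeight ρ P = ρ ^ d * coeffWeight 1 P := by
  rw [coeffWeight, coeffWeight, ← ENNReal.tsum_mul_left]
  refine tsum_congr fun α ↦ ?_
  by_cases h : P.coeff α = 0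
  · simp [h]
  · have : α.degree = d := by
      by_contra hne
      exact h (hP.coeff_eq_zero hne)
    rw [this, one_pow, one_mul]

lemma coeffWeight_one_eq_sum {n : ℕ} (P : MvPolynomial (Fin n) ℂ) :
    coeffWeight 1 P = ∑ α ∈ P.support, ‖P.coeff α‖ₑ ^ 2 := by
  rw [coeffWeight, tsum_eq_sum (s := P.support)]
  · simp
  · intro α hα
    simp [MvPolynomial.notMem_support_iff.mp hα]

lemma coeffWeight_one_ne_top {n : ℕ} (P : MvPolynomial (Fin n) ℂ) : coeffWeight 1 P ≠ ∞ := by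
  rw [coeffWeight_one_eq_sum]
  exact (ENNReal.sum_lt_top.mpr fun α _ ↦ ENNReal.pow_lt_top enorm_lt_top).ne

lemma measurable_enorm_eval_torusPt {n : ℕ} (P : MvPolynomial (Fin n) ℂ) :
    Measurable fun x ↦ ‖MvPolynomial.eval (torusPt x) P‖ₑ :=
  Continuous.measurable (by fun_prop)

lemma ENNReal.le_of_rpow_le_mul_rpow {a b : ℝ≥0∞} {s t : ℝ} (ha : a ≠ ∞) (hs : 0 < s) (ht : 0 ≤ t)
    (h : a ^ (s + t) ≤ b * a ^ t) : a ^ s ≤ b := by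
  rcases eq_or_ne a 0 with rfl | h0
  · simp [ENNReal.zero_rpow_of_pos hs]
  rw [ENNReal.rpow_add _ _ h0 ha] at h
  exact (ENNReal.mul_le_mul_iff_left (by simp [h0, ha]) (ENNReal.rpow_ne_top_of_nonneg ht ha)).mp h

/-- Comparison of the `L²` norm of a homogeneous polynomial on the torus with its `L^p` norm, where
`p < 2` is conjugate to `2 + 2δ`; the constant `(1 + δ + 2δ²)^{d/2}` is sharp to first order. -/
theorem rpow_coeffWeight_le_lintegral {δ : ℝ} (hδ : 0 < δ) (hδ2 : δ ≤ 1 / 2) {n d : ℕ}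
    {P : MvPolynomial (Fin n) ℂ} (hP : P.IsHomogeneous d) {p : ℝ}
    (hp : p.HolderConjugate (2 + 2 * δ)) :
    coeffWeight 1 P ^ (1 / 2 : ℝ) ≤ (ENNReal.ofReal (1 + δ + 2 * δ ^ 2) ^ d) ^ (1 / 2 : ℝ)
      * (∫⁻ x, ‖MvPolynomial.eval (torusPt x) P‖ₑ ^ p ∂torusMeasure n) ^ (1 / p) := by
  set A := coeffWeight 1 P with hA
  set ρ := ENNReal.ofReal (1 + δ + 2 * δ ^ 2)
  have h1 := ENNReal.lintegral_mul_le_Lp_mul_Lq (torusMeasure n) hp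
    (measurable_enorm_eval_torusPt P).aemeasurable (measurable_enorm_eval_torusPt P).aemeasurable
  simp only [Pi.mul_apply, ← pow_two] at h1
  rw [lintegral_torus_sq, ← hA] at h1
  have h2 := ENNReal.rpow_le_rpow (lintegral_torus_rpow_le hδ.le hδ2 P)
    (show 0 ≤ 1 / (2 + 2 * δ) by positivity)
  rw [← ENNReal.rpow_mul, coeffWeight_of_isHomogeneous hP, ← hA,
    show (1 + δ) * (1 / (2 + 2 * δ)) = 1 / 2 by field_simp,
    ENNReal.mul_rpow_of_nonneg _ _ (by norm_num)] at h2
  refine ENNReal.le_of_rpow_le_mul_rpow (coeffWeight_one_ne_top P) (by norm_num)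
    (show (0 : ℝ) ≤ 1 / 2 by norm_num) ?_
  rw [show (1 / 2 : ℝ) + 1 / 2 = 1 by norm_num, ENNReal.rpow_one]
  refine h1.trans ((mul_le_mul_right h2 _).trans (le_of_eq ?_))
  ring

/-- A Khinchine-type inequality: the `L²` norm of a homogeneous polynomial on the torus is
controlled by its `L^p` norm, for every `p ≥ 1`. -/
theorem rpow_coeffWeight_le_lintegral_of_one_le {n d : ℕ}
    {P : MvPolynomial (Fin n) ℂ} (hP : P.IsHomogeneous d) {p : ℝ} (hp : 1 ≤ p) :
    coeffWeight 1 P ^ (1 / 2 : ℝ) ≤ ((2 : ℝ≥0∞) ^ d) ^ (3 / 2 : ℝ)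
      * (∫⁻ x, ‖MvPolynomial.eval (torusPt x) P‖ₑ ^ p ∂torusMeasure n) ^ (1 / p) := by
  set A := coeffWeight 1 P with hA
  set Y := ∫⁻ x, ‖MvPolynomial.eval (torusPt x) P‖ₑ ∂torusMeasure n with hY
  have hYp : Y ≤ (∫⁻ x, ‖MvPolynomial.eval (torusPt x) P‖ₑ ^ p ∂torusMeasure n) ^ (1 / p) := by
    have := eLpNorm'_le_eLpNorm'_of_exponent_le (p := 1) (q := p) one_pos hp (torusMeasure n)
      (continuous_eval_torusPt P).aestronglyMeasurable
    simpa [eLpNorm', hY] using this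
  have hm := measurable_enorm_eval_torusPt P
  have h1 := ENNReal.lintegral_mul_le_Lp_mul_Lq (torusMeasure n) Real.HolderConjugate.two_two
    (hm.pow_const (1 / 2 : ℝ)).aemeasurable (hm.pow_const (3 / 2 : ℝ)).aemeasurable
  have e1 : ∀ a : ℝ≥0∞, a ^ (1 / 2 : ℝ) * a ^ (3 / 2 : ℝ) = a ^ 2 := fun a ↦ by
    rw [← ENNReal.rpow_add_of_nonneg _ _ (by norm_num) (by norm_num), ← ENNReal.rpow_natCast]
    norm_num
  have e2 : ∀ a : ℝ≥0∞, (a ^ (1 / 2 : ℝ)) ^ (2 : ℝ) = a := fun a ↦ by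
    rw [← ENNReal.rpow_mul]; norm_num
  have e3 : ∀ a : ℝ≥0∞, (a ^ (3 / 2 : ℝ)) ^ (2 : ℝ) = a ^ (2 + 2 * (1 / 2) : ℝ) := fun a ↦ by
    rw [← ENNReal.rpow_mul]; norm_num
  simp only [Pi.mul_apply, e1, e2, e3] at h1
  rw [lintegral_torus_sq, ← hA, ← hY] at h1
  have h2 := ENNReal.rpow_le_rpow (lintegral_torus_rpow_le (δ := 1 / 2) (by norm_num) le_rfl P)
    (show (0 : ℝ) ≤ 1 / 2 by norm_num)
  have hρ : ENNReal.ofReal (1 + 1 / 2 + 2 * (1 / 2) ^ 2) = 2 := by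
    rw [show (1 + 1 / 2 + 2 * (1 / 2) ^ 2 : ℝ) = ((2 : ℕ) : ℝ) by norm_num, ENNReal.ofReal_natCast]
    rfl
  rw [coeffWeight_of_isHomogeneous hP, ← hA, hρ, ← ENNReal.rpow_mul,
    show (1 + 1 / 2 : ℝ) * (1 / 2) = 3 / 4 by norm_num,
    ENNReal.mul_rpow_of_nonneg _ _ (by norm_num)] at h2
  have h3 : A ^ (1 / 4 : ℝ) ≤ Y ^ (1 / 2 : ℝ) * ((2 : ℝ≥0∞) ^ d) ^ (3 / 4 : ℝ) := by
    refine ENNReal.le_of_rpow_le_mul_rpow (coeffWeight_one_ne_top P) (by norm_num)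
      (show (0 : ℝ) ≤ 3 / 4 by norm_num) ?_
    rw [show (1 / 4 : ℝ) + 3 / 4 = 1 by norm_num, ENNReal.rpow_one]
    refine h1.trans ((mul_le_mul_right h2 _).trans (le_of_eq ?_))
    ring
  have h4 := ENNReal.rpow_le_rpow h3 (show (0 : ℝ) ≤ 2 by norm_num)
  rw [ENNReal.mul_rpow_of_nonneg _ _ (by norm_num), e2, ← ENNReal.rpow_mul, ← ENNReal.rpow_mul,
    show (1 / 4 : ℝ) * 2 = 1 / 2 by norm_num, show (3 / 4 : ℝ) * 2 = 3 / 2 by norm_num,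
    mul_comm] at h4
  exact h4.trans (by gcongr)

end Moments

/-! ### A symmetric form of Blei's inequality -/

section Blei

lemma sum_cons {α M : Type*} [Fintype α] [AddCommMonoid M] {n : ℕ} (f : (Fin (n + 1) → α) → M) :
    ∑ i, f i = ∑ t, ∑ i' : Fin n → α, f (Fin.cons t i') := by
  rw [← (Fin.consEquiv fun _ ↦ α).sum_comp, Fintype.sum_prod_type]
  rfl

lemma sum_insertNth {α M : Type*} [Fintype α] [AddCommMonoid M] {n : ℕ} (j : Fin (n + 1))
    (f : (Fin (n + 1) → α) → M) :
    ∑ i, f i = ∑ t, ∑ i' : Fin n → α, f (j.insertNth t i') := by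
  rw [← (Fin.insertNthEquiv (fun _ ↦ α) j).sum_comp, Fintype.sum_prod_type]
  rfl

/-- Hölder's inequality for several functions on a finite type. -/
lemma sum_prod_rpow_le {α ι : Type*} [Fintype α] (s : Finset ι) (f : ι → α → ℝ≥0∞) {p : ι → ℝ}
    (hp : ∑ i ∈ s, p i = 1) (hp0 : ∀ i ∈ s, 0 ≤ p i) :
    ∑ a, ∏ i ∈ s, f i a ^ p i ≤ ∏ i ∈ s, (∑ a, f i a) ^ p i := by
  let _ : MeasurableSpace α := ⊤
  have h := ENNReal.lintegral_prod_norm_pow_le (μ := MeasureTheory.Measure.count) s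
    (f := f) (fun i _ ↦ (measurable_of_finite _).aemeasurable) hp hp0
  simpa only [MeasureTheory.lintegral_count, tsum_fintype] using h

/-- The Loomis-Whitney inequality for finite sums. -/
lemma sum_prod_succAbove_le {α : Type*} [Fintype α] {M : ℕ} (hM : 1 ≤ M)
    (F : Fin (M + 1) → (Fin M → α) → ℝ≥0∞) :
    ∑ i : Fin (M + 1) → α, ∏ j, F j (i ∘ j.succAbove)
      ≤ ∏ j, (∑ i' : Fin M → α, F j i' ^ (M : ℝ)) ^ (1 / (M : ℝ)) := by
  induction M, hM using Nat.le_induction with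
  | base =>
    have e : ∀ f : (Fin 1 → α) → ℝ≥0∞, ∑ i, f i = ∑ a, f fun _ ↦ a := fun f ↦ by
      rw [← (Equiv.funUnique (Fin 1) α).symm.sum_comp]; rfl
    rw [sum_cons]
    simp only [Nat.cast_one, ENNReal.rpow_one, div_one, e]
    simp_rw [Fin.prod_univ_two (M := ℝ≥0∞)]
    rw [mul_comm, Finset.sum_mul_sum]
    refine le_of_eq (Finset.sum_congr rfl fun a _ ↦ Finset.sum_congr rfl fun b _ ↦ ?_)
    rw [mul_comm]
    congr 2
    ext j; fin_cases j; rfl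
  | succ M hM ih =>
    have hM0 : (0 : ℝ) < M := by exact_mod_cast hM
    have hM1 : (0 : ℝ) < M + 1 := by positivity
    have hconj : ((M : ℝ) + 1).HolderConjugate (((M : ℝ) + 1) / M) := by
      rw [Real.holderConjugate_iff]
      constructor
      · linarith
      · field_simp; ring
    have hG : ∀ t : α, ∑ i : Fin (M + 1) → α,
          ∏ j, F j ((Fin.cons t i : Fin (M + 2) → α) ∘ j.succAbove)
        ≤ (∑ i : Fin (M + 1) → α, F 0 i ^ ((M : ℝ) + 1)) ^ (1 / ((M : ℝ) + 1))
          * ∏ j : Fin (M + 1), (∑ i' : Fin M → α,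
              F j.succ (Fin.cons t i') ^ ((M : ℝ) + 1)) ^ (1 / ((M : ℝ) + 1)) := by
      intro t
      have e0 : ∀ i : Fin (M + 1) → α,
          (Fin.cons t i : Fin (M + 2) → α) ∘ (0 : Fin (M + 2)).succAbove = i := by
        intro i; ext j; simp
      have e1 : ∀ (i : Fin (M + 1) → α) (j : Fin (M + 1)),
          (Fin.cons t i : Fin (M + 2) → α) ∘ j.succ.succAbove
            = Fin.cons t (i ∘ j.succAbove) := by
        intro i j; ext l
        refine Fin.cases ?_ (fun l ↦ ?_) l <;> simp
      simp_rw [Fin.prod_univ_succ (n := M + 1), e0, e1]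
      refine (ENNReal.inner_le_Lp_mul_Lq Finset.univ _ _ hconj).trans ?_
      refine mul_le_mul_right ?_ _
      have hr : 0 ≤ ((M : ℝ) + 1) / M := by positivity
      have hr' : 0 ≤ 1 / (((M : ℝ) + 1) / M) := by positivity
      have h1 := ENNReal.rpow_le_rpow (ih fun j i' ↦ F j.succ (Fin.cons t i') ^ (((M : ℝ) + 1) / M))
        hr'
      have h2 : ∀ i : Fin (M + 1) → α, (∏ j : Fin (M + 1), F j.succ (Fin.cons t (i ∘ j.succAbove)))
            ^ (((M : ℝ) + 1) / M)
          = ∏ j : Fin (M + 1), F j.succ (Fin.cons t (i ∘ j.succAbove)) ^ (((M : ℝ) + 1) / M) :=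
        fun i ↦ (ENNReal.prod_rpow_of_nonneg hr).symm
      simp only [h2]
      refine h1.trans (le_of_eq ?_)
      rw [← ENNReal.prod_rpow_of_nonneg hr']
      refine Finset.prod_congr rfl fun j _ ↦ ?_
      have h3 : ((M : ℝ) + 1) / M * M = M + 1 := by field_simp
      have h4 : 1 / (M : ℝ) * (1 / (((M : ℝ) + 1) / M)) = 1 / ((M : ℝ) + 1) := by field_simp
      simp only [← ENNReal.rpow_mul, h3, h4]
    rw [sum_cons]
    refine (Finset.sum_le_sum fun t _ ↦ hG t).trans ?_
    rw [← Finset.mul_sum]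
    push_cast
    rw [Fin.prod_univ_succ (n := M + 1)]
    refine mul_le_mul_right ?_ _
    refine (sum_prod_rpow_le Finset.univ
      (fun (j : Fin (M + 1)) t ↦ ∑ i' : Fin M → α, F j.succ (Fin.cons t i') ^ ((M : ℝ) + 1))
      (p := fun _ ↦ 1 / ((M : ℝ) + 1)) ?_ fun _ _ ↦ by positivity).trans ?_
    · simp; field_simp
    · refine le_of_eq (Finset.prod_congr rfl fun j _ ↦ ?_)
      rw [sum_cons]

/-- The Bohnenblust-Hille exponent `2k / (k + 1)`. -/
noncomputable def bhExp (k : ℕ) : ℝ := 2 * k / (k + 1)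

lemma bhExp_pos {k : ℕ} (hk : 1 ≤ k) : 0 < bhExp k := by
  have : (0 : ℝ) < k := by exact_mod_cast hk
  unfold bhExp; positivity

lemma one_le_bhExp {k : ℕ} (hk : 1 ≤ k) : 1 ≤ bhExp k := by
  have : (1 : ℝ) ≤ k := by exact_mod_cast hk
  unfold bhExp
  rw [le_div_iff₀ (by positivity)]; linarith

/-- One step of Blei's inequality for symmetric functions `b` of `M + 1` indices: the `ℓ^p` norm of
`b` with the Bohnenblust-Hille exponent of `M + 1` is bounded by the mixed norm that is `ℓ²` in one
index and `ℓ^{p'}` in the others, with the exponent `p'` of `M`. It is Hölder's inequality applied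
to the functions `b² φ_j^{p' - 2}`, where `φ_j` is the `ℓ²` norm in the `j`-th index, and to
`∏ φ_j^{2/(M+1)}`, which is handled by the Loomis-Whitney inequality. -/
theorem sum_rpow_bhExp_succ_le {α : Type*} [Fintype α] {M : ℕ} (hM : 1 ≤ M)
    (b : (Fin (M + 1) → α) → ℝ≥0∞) (hb : ∀ i, b i ≠ ∞)
    (hsym : ∀ (j : Fin (M + 1)) t i, b (j.insertNth t i) = b (Fin.cons t i)) :
    (∑ i, b i ^ bhExp (M + 1)) ^ (1 / bhExp (M + 1))
      ≤ (∑ i' : Fin M → α, ((∑ t, b (Fin.cons t i') ^ 2) ^ (1 / 2 : ℝ)) ^ bhExp M)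
        ^ (1 / bhExp M) := by
  have hM0 : (0 : ℝ) < M := by exact_mod_cast hM
  set φ : (Fin M → α) → ℝ≥0∞ := fun i' ↦ (∑ t, b (Fin.cons t i') ^ 2) ^ (1 / 2 : ℝ) with hφ
  have hφ2 : ∀ i', φ i' ^ 2 = ∑ t, b (Fin.cons t i') ^ 2 := by
    intro i'
    rw [hφ, ← ENNReal.rpow_natCast, ← ENNReal.rpow_mul]; norm_num
  have hφtop : ∀ i', φ i' ≠ ∞ := by
    intro i' h
    have h1 := hφ2 i'
    rw [h, eq_comm] at h1
    exact (ENNReal.sum_lt_top.mpr fun t _ ↦ ENNReal.pow_lt_top (hb _).lt_top).ne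
      (h1.trans (by simp))
  set S := ∑ i' : Fin M → α, φ i' ^ bhExp M with hS
  have hins : ∀ (i : Fin (M + 1) → α) (j : Fin (M + 1)),
      b i = b (Fin.cons (i j) (i ∘ j.succAbove)) := by
    intro i j
    rw [← hsym j]
    congr 1
    exact (Fin.insertNth_self_removeNth j i).symm
  set β : ℝ := -2 / (M + 1) with hβ
  -- the sum of `b² φ_j^β` does not exceed `S`, for each `j`
  have hX : ∀ j : Fin (M + 1), ∑ i, b i ^ 2 * φ (i ∘ j.succAbove) ^ β ≤ S := by
    intro j
    rw [sum_insertNth j, Finset.sum_comm]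
    refine Finset.sum_le_sum fun i' _ ↦ ?_
    have e : ∀ t, (j.insertNth t i' : Fin (M + 1) → α) ∘ j.succAbove = i' := by
      intro t; ext l; simp
    simp_rw [e, hsym]
    rw [← Finset.sum_mul, ← hφ2]
    rcases eq_or_ne (φ i') 0 with h0 | h0
    · simp [h0]
    · refine le_of_eq ?_
      rw [← ENNReal.rpow_natCast, ← ENNReal.rpow_add _ _ h0 (hφtop i')]
      congr 1
      rw [hβ, bhExp]; push_cast; field_simp; ring
  have hLW := sum_prod_succAbove_le hM fun (_ : Fin (M + 1)) i' ↦ φ i' ^ (2 / ((M : ℝ) + 1))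
  have e1 : ∀ i', (φ i' ^ (2 / ((M : ℝ) + 1))) ^ (M : ℝ) = φ i' ^ bhExp M := by
    intro i'
    rw [← ENNReal.rpow_mul]; congr 1; rw [bhExp]; field_simp
  simp_rw [e1] at hLW
  rw [← hS, Finset.prod_const, Finset.card_univ, Fintype.card_fin] at hLW
  -- the pointwise factorisation of `b`
  have hpt : ∀ i, b i ^ bhExp (M + 1)
      ≤ ∏ o : Option (Fin (M + 1)), (o.elim (∏ j : Fin (M + 1),
          φ (i ∘ j.succAbove) ^ (2 / ((M : ℝ) + 1)))
        fun j ↦ b i ^ 2 * φ (i ∘ j.succAbove) ^ β) ^ (1 / ((M : ℝ) + 2)) := by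
    intro i
    rw [Fintype.prod_option]
    simp only [Option.elim_none, Option.elim_some]
    rcases eq_or_ne (b i) 0 with h0 | h0
    · rw [h0, ENNReal.zero_rpow_of_pos (bhExp_pos (by omega))]; exact zero_le
    · have hφ0 : ∀ j : Fin (M + 1), φ (i ∘ j.succAbove) ≠ 0 := by
        intro j h
        have h1 := hφ2 (i ∘ j.succAbove)
        rw [h, eq_comm, zero_pow two_ne_zero, Finset.sum_eq_zero_iff] at h1
        have h2 := h1 (i j) (Finset.mem_univ _)
        rw [← hins] at h2
        exact h0 (pow_eq_zero_iff two_ne_zero |>.mp h2)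
      have hr : (0 : ℝ) ≤ 1 / ((M : ℝ) + 2) := by positivity
      refine le_of_eq ?_
      rw [← ENNReal.prod_rpow_of_nonneg hr, ← Finset.prod_mul_distrib]
      have e2 : ∀ j : Fin (M + 1), (φ (i ∘ j.succAbove) ^ (2 / ((M : ℝ) + 1))) ^ (1 / ((M : ℝ) + 2))
          * (b i ^ 2 * φ (i ∘ j.succAbove) ^ β) ^ (1 / ((M : ℝ) + 2))
          = b i ^ (2 / ((M : ℝ) + 2)) := by
        intro j
        rw [← ENNReal.mul_rpow_of_nonneg _ _ hr, mul_left_comm,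
          ← ENNReal.rpow_add _ _ (hφ0 j) (hφtop _), hβ, neg_div, add_neg_cancel, ENNReal.rpow_zero,
          mul_one, ← ENNReal.rpow_natCast, ← ENNReal.rpow_mul]
        congr 1; push_cast; ring
      rw [Finset.prod_congr rfl fun j _ ↦ e2 j, Finset.prod_const, Finset.card_univ,
        Fintype.card_fin, ← ENNReal.rpow_natCast, ← ENNReal.rpow_mul]
      congr 1
      rw [bhExp]; push_cast; field_simp; ring
  have hsum := (Finset.sum_le_sum fun i _ ↦ hpt i).trans
    (sum_prod_rpow_le Finset.univ (fun (o : Option (Fin (M + 1))) i ↦ o.elim (∏ j : Fin (M + 1),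
          φ (i ∘ j.succAbove) ^ (2 / ((M : ℝ) + 1)))
        fun j ↦ b i ^ 2 * φ (i ∘ j.succAbove) ^ β) (p := fun _ ↦ 1 / ((M : ℝ) + 2))
        (by simp; field_simp; ring) fun _ _ ↦ by positivity)
  rw [Fintype.prod_option] at hsum
  simp only [Option.elim_none, Option.elim_some] at hsum
  have hfin : ∑ i, b i ^ bhExp (M + 1)
      ≤ S ^ (((M : ℝ) + 1) ^ 2 / (M * (M + 2))) := by
    refine hsum.trans ?_
    refine (mul_le_mul' (ENNReal.rpow_le_rpow hLW (by positivity))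
      (Finset.prod_le_prod' fun j _ ↦ ENNReal.rpow_le_rpow (hX j) (by positivity))).trans
      (le_of_eq ?_)
    rw [Finset.prod_const, Finset.card_univ, Fintype.card_fin, ← ENNReal.rpow_natCast,
      ← ENNReal.rpow_natCast, ← ENNReal.rpow_mul, ← ENNReal.rpow_mul, ← ENNReal.rpow_mul,
      ← ENNReal.rpow_add_of_nonneg _ _ (by positivity) (by positivity)]
    congr 1
    push_cast
    field_simp
    ring
  have hq := bhExp_pos (k := M + 1) (by omega)
  refine (ENNReal.rpow_le_rpow hfin (by positivity)).trans (le_of_eq ?_)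
  rw [← ENNReal.rpow_mul]
  congr 1
  rw [bhExp, bhExp]; push_cast; field_simp; ring

end Blei

/-! ### Iterated derivatives and the multilinear Bohnenblust-Hille inequality -/

section Derivatives
open MvPolynomial MeasureTheory

/-- The iterated partial derivative `∂_{i 0} ⋯ ∂_{i (k-1)}`, as a linear map. -/
noncomputable def iterPderiv {n : ℕ} :
    (k : ℕ) → (Fin k → Fin n) → MvPolynomial (Fin n) ℂ →ₗ[ℂ] MvPolynomial (Fin n) ℂ
  | 0, _ => LinearMap.id
  | k + 1, i => iterPderiv k (Fin.tail i) ∘ₗ (pderiv (i 0)).toLinearMap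

/-- The derivative `∑ w_t ∂_t` in the direction of the vector `w`. -/
noncomputable def dirDeriv {n : ℕ} (w : Fin n → ℂ) (R : MvPolynomial (Fin n) ℂ) :
    MvPolynomial (Fin n) ℂ :=
  ∑ t, w t • pderiv t R

/-- The iterated directional derivative in the directions `w 0, …, w (k - 1)`. -/
noncomputable def iterDirDeriv {n : ℕ} :
    (k : ℕ) → (Fin k → Fin n → ℂ) → MvPolynomial (Fin n) ℂ → MvPolynomial (Fin n) ℂ
  | 0, _, R => R
  | k + 1, w, R => iterDirDeriv k (Fin.tail w) (dirDeriv (w 0) R)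

/-- The exponent of the monomial `∏_j X_{i j}`. -/
noncomputable def indexType {n k : ℕ} (i : Fin k → Fin n) : Fin n →₀ ℕ :=
  ∑ j, Finsupp.single (i j) 1

/-- The factorial `∏_t (β t)!` of a monomial exponent. -/
def multiFactorial {n : ℕ} (β : Fin n →₀ ℕ) : ℕ := ∏ t, (β t).factorial

lemma multiFactorial_pos {n : ℕ} (β : Fin n →₀ ℕ) : 0 < multiFactorial β :=
  Finset.prod_pos fun _ _ ↦ Nat.factorial_pos _

lemma multiFactorial_add_single {n : ℕ} (β : Fin n →₀ ℕ) (t : Fin n) :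
    multiFactorial (β + Finsupp.single t 1) = (β t + 1) * multiFactorial β := by
  rw [multiFactorial, multiFactorial, ← Finset.mul_prod_erase _ _ (Finset.mem_univ t),
    ← Finset.mul_prod_erase Finset.univ (fun t ↦ (β t).factorial) (Finset.mem_univ t), ← mul_assoc]
  congr 1
  · simp [Nat.factorial_succ]
  · refine Finset.prod_congr rfl fun s hs ↦ ?_
    have : t ≠ s := (Finset.ne_of_mem_erase hs).symm
    simp [this]

lemma indexType_cons {n k : ℕ} (t : Fin n) (i : Fin k → Fin n) :
    indexType (Fin.cons t i : Fin (k + 1) → Fin n) = Finsupp.single t 1 + indexType i := by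
  simp [indexType, Fin.sum_univ_succ]

lemma indexType_insertNth {n k : ℕ} (j : Fin (k + 1)) (t : Fin n) (i : Fin k → Fin n) :
    indexType (j.insertNth t i : Fin (k + 1) → Fin n) = Finsupp.single t 1 + indexType i := by
  simp [indexType, Fin.sum_univ_succAbove _ j]

lemma iterPderiv_cons {n k : ℕ} (t : Fin n) (i : Fin k → Fin n) (R : MvPolynomial (Fin n) ℂ) :
    iterPderiv (k + 1) (Fin.cons t i) R = iterPderiv k i (pderiv t R) := by
  simp [iterPderiv]

lemma iterDirDeriv_cons {n k : ℕ} (v : Fin n → ℂ) (w : Fin k → Fin n → ℂ)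
    (R : MvPolynomial (Fin n) ℂ) :
    iterDirDeriv (k + 1) (Fin.cons v w) R = iterDirDeriv k w (dirDeriv v R) := by
  rw [iterDirDeriv, Fin.tail_cons, Fin.cons_zero]

lemma coeff_iterPderiv {n k : ℕ} (i : Fin k → Fin n) (R : MvPolynomial (Fin n) ℂ)
    (β : Fin n →₀ ℕ) :
    (iterPderiv k i R).coeff β * multiFactorial β
      = R.coeff (β + indexType i) * multiFactorial (β + indexType i) := by
  induction k generalizing R with
  | zero => simp [iterPderiv, indexType]
  | succ k ih =>
    obtain ⟨t, i, rfl⟩ : ∃ t i', i = Fin.cons t i' := ⟨i 0, Fin.tail i, (Fin.cons_self_tail i).symm⟩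
    rw [iterPderiv_cons, ih, coeff_pderiv, indexType_cons, add_comm (Finsupp.single t 1),
      ← add_assoc, multiFactorial_add_single]
    push_cast
    ring

lemma iterPderiv_insertNth {n k : ℕ} (j : Fin (k + 1)) (t : Fin n) (i : Fin k → Fin n)
    (R : MvPolynomial (Fin n) ℂ) :
    iterPderiv (k + 1) (j.insertNth t i) R = iterPderiv (k + 1) (Fin.cons t i) R := by
  ext β
  have h : ((multiFactorial β : ℕ) : ℂ) ≠ 0 := by exact_mod_cast (multiFactorial_pos β).ne'
  refine mul_right_cancel₀ h ?_
  rw [coeff_iterPderiv, coeff_iterPderiv, indexType_cons, indexType_insertNth]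

lemma isHomogeneous_iterPderiv {n k m : ℕ} (i : Fin k → Fin n) {R : MvPolynomial (Fin n) ℂ}
    (hR : R.IsHomogeneous m) : (iterPderiv k i R).IsHomogeneous (m - k) := by
  induction k generalizing R m with
  | zero => simpa [iterPderiv] using hR
  | succ k ih =>
    have := ih (Fin.tail i) (hR.pderiv (i := i 0))
    rwa [Nat.sub_sub, add_comm 1 k] at this

lemma sum_enorm_sq_le_coeffWeight {n : ℕ} (b : Fin n → ℂ) :
    ∑ t, ‖b t‖ₑ ^ 2 ≤ coeffWeight 1 (∑ t, C (b t) * X t) := by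
  have hinj : Function.Injective fun t : Fin n ↦ Finsupp.single t 1 :=
    Finsupp.single_left_injective one_ne_zero
  refine le_trans (le_of_eq ?_) (ENNReal.tsum_comp_le_tsum_of_injective hinj _)
  rw [tsum_fintype]
  refine Finset.sum_congr rfl fun t _ ↦ ?_
  simp [coeff_sum, coeff_C_mul, coeff_X, Finsupp.single_left_inj]

lemma isHomogeneous_linearForm {n : ℕ} (b : Fin n → ℂ) :
    (∑ t, C (b t) * X t : MvPolynomial (Fin n) ℂ).IsHomogeneous 1 :=
  IsHomogeneous.sum _ _ _ fun t _ ↦ by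
    simpa using (isHomogeneous_C (Fin n) (b t)).mul (isHomogeneous_X ℂ t)

lemma sum_enorm_pderiv_le {n : ℕ} (z : Fin n → ℂ) (R : MvPolynomial (Fin n) ℂ)
    (A : ℝ≥0∞) (h : ∀ w : Fin n → ℂ, (∀ t, ‖w t‖ = 1) → ‖eval z (dirDeriv w R)‖ₑ ≤ A) :
    ∑ t, ‖eval z (pderiv t R)‖ₑ ≤ A := by
  -- choose the phases that make all terms of the linear form nonnegative
  set a : Fin n → ℂ := fun t ↦ eval z (pderiv t R)
  set w : Fin n → ℂ := fun t ↦ if a t = 0 then 1 else ‖a t‖ / a t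
  have hw : ∀ t, w t * a t = ‖a t‖ := by
    intro t
    by_cases h0 : a t = 0
    · simp [h0]
    · simp [w, h0]
  have hw1 : ∀ t, ‖w t‖ = 1 := by
    intro t
    by_cases h0 : a t = 0
    · simp [w, h0]
    · simp [w, h0]
  refine le_trans (le_of_eq ?_) (h w hw1)
  have e2 : eval z (dirDeriv w R) = ((∑ t, ‖a t‖ : ℝ) : ℂ) := by
    simp only [dirDeriv, map_sum, smul_eval, Complex.ofReal_sum, ← hw, a]
  rw [e2, ← ofReal_norm, Complex.norm_of_nonneg (by positivity),
    ENNReal.ofReal_sum_of_nonneg fun _ _ ↦ norm_nonneg _]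
  simp only [ofReal_norm, a]

/-- The multilinear Bohnenblust-Hille inequality, for the symmetric multilinear form
`(w_0, …, w_k) ↦ ∂_{w_0} ⋯ ∂_{w_k} R (z)`. -/
theorem sum_enorm_iterPderiv_rpow_le {n : ℕ} (z : Fin n → ℂ) (k : ℕ) (R : MvPolynomial (Fin n) ℂ)
    (A : ℝ≥0∞) (h : ∀ w : Fin (k + 1) → Fin n → ℂ, (∀ j t, ‖w j t‖ = 1) →
      ‖eval z (iterDirDeriv (k + 1) w R)‖ₑ ≤ A) :
    (∑ i : Fin (k + 1) → Fin n, ‖eval z (iterPderiv (k + 1) i R)‖ₑ ^ bhExp (k + 1))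
      ^ (1 / bhExp (k + 1)) ≤ ((2 : ℝ≥0∞) ^ (3 / 2 : ℝ)) ^ k * A := by
  induction k generalizing R with
  | zero =>
    have e : bhExp (0 + 1) = 1 := by norm_num [bhExp]
    simp only [e, ENNReal.rpow_one, div_one, pow_zero, one_mul]
    rw [sum_cons]
    simp only [iterPderiv_cons, Finset.univ_unique, Finset.sum_singleton]
    exact sum_enorm_pderiv_le z R A fun w hw ↦ h (fun _ ↦ w) fun _ ↦ hw
  | succ k ih =>
    have hq := one_le_bhExp (k := k + 1) (by omega)
    have hq0 : 0 < bhExp (k + 1) := by linarith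
    refine (sum_rpow_bhExp_succ_le (M := k + 1) (by omega)
      (fun i ↦ ‖eval z (iterPderiv (k + 2) i R)‖ₑ) (fun _ ↦ enorm_ne_top) fun j t i ↦ by
        simp only [iterPderiv_insertNth]).trans ?_
    set K : ℝ≥0∞ := (2 : ℝ≥0∞) ^ (3 / 2 : ℝ) with hK
    have hkh : ∀ i' : Fin (k + 1) → Fin n,
        ((∑ t, ‖eval z (iterPderiv (k + 2) (Fin.cons t i') R)‖ₑ ^ 2) ^ (1 / 2 : ℝ)) ^ bhExp (k + 1)
        ≤ K ^ bhExp (k + 1) * ∫⁻ x, ‖eval z (iterPderiv (k + 1) i' (dirDeriv (torusPt x) R))‖ₑ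
            ^ bhExp (k + 1) ∂torusMeasure n := by
      intro i'
      have h1 := (ENNReal.rpow_le_rpow (sum_enorm_sq_le_coeffWeight fun t ↦
          eval z (iterPderiv (k + 2) (Fin.cons t i') R)) (by norm_num)).trans
        (rpow_coeffWeight_le_lintegral_of_one_le (isHomogeneous_linearForm _) hq)
      refine (ENNReal.rpow_le_rpow h1 hq0.le).trans (le_of_eq ?_)
      rw [ENNReal.mul_rpow_of_nonneg _ _ hq0.le, pow_one, ← ENNReal.rpow_mul _ (1 / bhExp (k + 1)),
        one_div_mul_cancel hq0.ne', ENNReal.rpow_one]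
      congr 1
      refine lintegral_congr fun x ↦ ?_
      congr 2
      simp only [iterPderiv_cons, map_sum, dirDeriv, map_smul, smul_eval, map_mul, eval_C, eval_X]
      exact Finset.sum_congr rfl fun t _ ↦ mul_comm _ _
    have hint : ∀ x, ∑ i' : Fin (k + 1) → Fin n,
        ‖eval z (iterPderiv (k + 1) i' (dirDeriv (torusPt x) R))‖ₑ ^ bhExp (k + 1)
        ≤ (K ^ k * A) ^ bhExp (k + 1) := by
      intro x
      have h2 := ih (dirDeriv (torusPt x) R) fun w hw ↦ by
        have := h (Fin.cons (torusPt x) w) fun j t ↦ by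
          refine Fin.cases ?_ (fun j ↦ ?_) j
          · simp [torusPt]
          · simp [hw]
        rwa [iterDirDeriv_cons] at this
      rwa [one_div, ENNReal.rpow_inv_le_iff hq0] at h2
    rw [one_div (bhExp (k + 1)), ENNReal.rpow_inv_le_iff hq0]
    refine (Finset.sum_le_sum fun i' _ ↦ hkh i').trans ?_
    rw [← Finset.mul_sum, ← lintegral_finsetSum]
    · refine (mul_le_mul_right (lintegral_mono hint) _).trans (le_of_eq ?_)
      rw [lintegral_const, measure_univ, mul_one, ← ENNReal.mul_rpow_of_nonneg _ _ hq0.le,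
        ← mul_assoc, pow_succ']
    · intro i' _
      refine (Measurable.enorm (Continuous.measurable ?_)).pow_const _
      simp only [dirDeriv, map_sum, map_smul, smul_eval]
      refine continuous_finsetSum _ fun t _ ↦ ?_
      exact ((continuous_apply t).comp continuous_torusPt).mul continuous_const

end Derivatives

/-! ### Cauchy's estimate on polydisks -/

section Cauchy
open MvPolynomial

lemma hasDerivAt_eval_add_smul {n : ℕ} (Q : MvPolynomial (Fin n) ℂ) (z w : Fin n → ℂ) (s : ℂ) :
    HasDerivAt (fun s : ℂ ↦ eval (z + s • w) Q) (eval (z + s • w) (dirDeriv w Q)) s := by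
  simp only [dirDeriv, map_sum, smul_eval]
  induction Q using MvPolynomial.induction_on with
  | C a => simpa using hasDerivAt_const s a
  | add p q hp hq =>
    simp only [map_add, mul_add, Finset.sum_add_distrib]
    exact hp.add hq
  | mul_X p i hp =>
    have h1 : HasDerivAt (fun s : ℂ ↦ z i + s * w i) (w i) s := by
      simpa using ((hasDerivAt_id s).mul_const (w i)).const_add (z i)
    simp only [map_mul, eval_X]
    refine (hp.mul h1).congr_deriv ?_
    have e : ∀ t, w t * eval (z + s • w) (pderiv t (p * X i))
        = w t * eval (z + s • w) (pderiv t p) * (z i + s * w i)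
          + if t = i then eval (z + s • w) p * w i else 0 := by
      intro t
      rw [pderiv_mul, pderiv_X]
      by_cases ht : t = i
      · subst ht; simp; ring
      · simp [ht, Ne.symm ht]; ring
    simp only [e, Finset.sum_add_distrib, Finset.sum_mul, Finset.sum_ite_eq', Finset.mem_univ,
      if_true]

/-- Cauchy's estimate for iterated directional derivatives. -/
lemma norm_eval_iterDirDeriv_le {n k : ℕ} {ρ M s : ℝ} (hρ : 0 < ρ)
    (Q : MvPolynomial (Fin n) ℂ)
    (hQ : ∀ z : Fin n → ℂ, (∀ t, ‖z t‖ ≤ s + k * ρ) → ‖eval z Q‖ ≤ M)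
    (w : Fin k → Fin n → ℂ) (hw : ∀ j t, ‖w j t‖ = 1) (z : Fin n → ℂ) (hz : ∀ t, ‖z t‖ ≤ s) :
    ‖eval z (iterDirDeriv k w Q)‖ ≤ M / ρ ^ k := by
  induction k generalizing Q M with
  | zero => simpa [iterDirDeriv] using hQ z (by simpa using hz)
  | succ k ih =>
    rw [pow_succ', ← div_div]
    refine ih (dirDeriv (w 0) Q) (fun y hy ↦ ?_) (Fin.tail w) fun j t ↦ hw j.succ t
    have hd := fun s ↦ hasDerivAt_eval_add_smul Q y (w 0) s
    have h0 := (hd 0).deriv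
    rw [zero_smul, add_zero] at h0
    rw [← h0]
    refine Complex.norm_deriv_le_of_forall_mem_sphere_norm_le hρ
      (Differentiable.diffContOnCl fun s ↦ (hd s).differentiableAt) fun u hu ↦ ?_
    refine hQ _ fun t ↦ ?_
    have hu' : ‖u‖ = ρ := by simpa using hu
    calc ‖(y + u • w 0) t‖ ≤ ‖y t‖ + ‖u‖ * ‖w 0 t‖ := by
          simpa using norm_add_le (y t) (u * w 0 t)
      _ ≤ s + k * ρ + ρ * 1 := by rw [hu', hw]; gcongr; exact hy t
      _ = s + (k + 1 : ℕ) * ρ := by push_cast; ring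

lemma bddAbove_polydisk {n : ℕ} (P : MvPolynomial (Fin n) ℂ) :
    BddAbove (Set.range fun z : {z : Fin n → ℂ // ∀ i, ‖z i‖ < 1} ↦ ‖eval z.1 P‖) := by
  refine ⟨∑ α ∈ P.support, ‖P.coeff α‖, ?_⟩
  rintro _ ⟨z, rfl⟩
  simp only [eval_eq]
  refine (norm_sum_le _ _).trans (Finset.sum_le_sum fun α _ ↦ ?_)
  rw [norm_mul, norm_prod]
  refine mul_le_of_le_one_right (norm_nonneg _) (Finset.prod_le_one (fun _ _ ↦ norm_nonneg _) ?_)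
  intro i _
  rw [norm_pow]
  exact pow_le_one₀ (norm_nonneg _) (z.2 i).le

lemma eval_smul_of_isHomogeneous {n m : ℕ} {P : MvPolynomial (Fin n) ℂ} (hP : P.IsHomogeneous m)
    (c : ℂ) (z : Fin n → ℂ) : eval (c • z) P = c ^ m * eval z P := by
  rw [eval_eq', eval_eq', Finset.mul_sum]
  refine Finset.sum_congr rfl fun α hα ↦ ?_
  have h : ∑ i, α i = m := by
    rw [← Finsupp.degree_eq_sum]
    by_contra hne
    exact (mem_support_iff.mp hα) (hP.coeff_eq_zero hne)
  simp only [Pi.smul_apply, smul_eq_mul, mul_pow, Finset.prod_mul_distrib,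
    Finset.prod_pow_eq_pow_sum, h]
  ring

lemma polydiskNorm_nonneg {n : ℕ} (P : MvPolynomial (Fin n) ℂ) : 0 ≤ polydiskNorm P :=
  Real.iSup_nonneg fun _ ↦ norm_nonneg _

/-- A homogeneous polynomial on the closed polydisk of radius `s`. -/
lemma norm_eval_le_polydiskNorm {n m : ℕ} {P : MvPolynomial (Fin n) ℂ} (hP : P.IsHomogeneous m)
    {s : ℝ} (hs : 0 < s) {z : Fin n → ℂ} (hz : ∀ i, ‖z i‖ ≤ s) :
    ‖eval z P‖ ≤ s ^ m * polydiskNorm P := by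
  have h1 : ∀ r ∈ Set.Ioo (0 : ℝ) 1, r ^ m * ‖eval z P‖ ≤ s ^ m * polydiskNorm P := by
    rintro r ⟨hr0, hr1⟩
    have hmem : ∀ i, ‖(((r / s : ℝ) : ℂ) • z) i‖ < 1 := by
      intro i
      rw [Pi.smul_apply, norm_smul, Complex.norm_of_nonneg (by positivity), div_mul_eq_mul_div,
        div_lt_one hs]
      nlinarith [hz i, norm_nonneg (z i)]
    have h2 : ‖eval (((r / s : ℝ) : ℂ) • z) P‖ ≤ polydiskNorm P :=
      le_ciSup (bddAbove_polydisk P) ⟨_, hmem⟩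
    rw [eval_smul_of_isHomogeneous hP, norm_mul, norm_pow,
      Complex.norm_of_nonneg (by positivity), div_pow, div_mul_eq_mul_div,
      div_le_iff₀ (by positivity)] at h2
    linarith
  have h3 : Filter.Tendsto (fun r : ℝ ↦ r ^ m * ‖eval z P‖) (nhdsWithin 1 (Set.Iio 1))
      (nhds (1 ^ m * ‖eval z P‖)) :=
    (Continuous.tendsto (by fun_prop) 1).mono_left nhdsWithin_le_nhds
  rw [one_pow, one_mul] at h3
  exact le_of_tendsto h3 (Filter.eventually_of_mem (Ioo_mem_nhdsLT one_pos) h1)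

/-- The derivatives of order `k` of an `m`-homogeneous polynomial on the closed unit polydisk; this
is Cauchy's estimate with polydisks of radius `1 / m`. -/
lemma norm_eval_iterDirDeriv_le_polydiskNorm {n m k : ℕ} (hm : 1 ≤ m)
    {P : MvPolynomial (Fin n) ℂ} (hP : P.IsHomogeneous m)
    (w : Fin k → Fin n → ℂ) (hw : ∀ j t, ‖w j t‖ = 1) (z : Fin n → ℂ) (hz : ∀ t, ‖z t‖ ≤ 1) :
    ‖eval z (iterDirDeriv k w P)‖ ≤ m ^ k * Real.exp k * polydiskNorm P := by
  have hm0 : (0 : ℝ) < m := by exact_mod_cast hm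
  refine (norm_eval_iterDirDeriv_le (ρ := 1 / m) (s := 1) (by positivity) P
    (fun y hy ↦ norm_eval_le_polydiskNorm hP (by positivity) hy) w hw z hz).trans ?_
  rw [one_div, inv_pow, div_inv_eq_mul, mul_comm, ← mul_assoc]
  refine mul_le_mul_of_nonneg_right (mul_le_mul_of_nonneg_left ?_ (by positivity))
    (polydiskNorm_nonneg P)
  have h1 : 1 + (k : ℝ) * (m : ℝ)⁻¹ ≤ Real.exp (k * (m : ℝ)⁻¹) := by
    linarith [Real.add_one_le_exp ((k : ℝ) * (m : ℝ)⁻¹)]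
  refine (pow_le_pow_left₀ (by positivity) h1 m).trans (le_of_eq ?_)
  rw [← Real.exp_nat_mul]
  congr 1
  field_simp

end Cauchy

/-! ### Multi-indices and monomial exponents -/

section Polarization
open MvPolynomial MeasureTheory

lemma degree_indexType {n k : ℕ} (i : Fin k → Fin n) : (indexType i).degree = k := by
  simp [indexType]

lemma multiFactorial_le_of_degree {n : ℕ} (β : Fin n →₀ ℕ) :
    multiFactorial β ≤ β.degree.factorial := by
  rw [Finsupp.degree_eq_sum]
  exact Nat.le_of_dvd (Nat.factorial_pos _) (Nat.prod_factorial_dvd_factorial_sum _ _)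

lemma multiFactorial_mono {n : ℕ} : Monotone (multiFactorial (n := n)) := fun _ _ h ↦
  Finset.prod_le_prod' fun t _ ↦ Nat.factorial_le (h t)

/-- Summation over multi-indices `j ∈ {1, …, n}^d` in terms of monomial exponents of degree `d`:
the exponent `β` comes from `d! / β!` multi-indices. -/
lemma sum_multiFactorial_mul {n : ℕ} (d : ℕ) (F : (Fin n →₀ ℕ) → ℝ≥0∞) :
    ∑ j : Fin d → Fin n, multiFactorial (indexType j) * F (indexType j)
      = d.factorial * ∑' β : Fin n →₀ ℕ, if β.degree = d then F β else 0 := by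
  induction d generalizing F with
  | zero =>
    rw [tsum_eq_single 0]
    · simp [indexType, multiFactorial]
    · intro β hβ
      simp [Finsupp.degree_eq_zero_iff, hβ]
  | succ d ih =>
    rw [sum_cons]
    have h1 : ∀ t : Fin n, ∑ j : Fin d → Fin n,
        (multiFactorial (indexType (Fin.cons t j : Fin (d + 1) → Fin n)) : ℝ≥0∞)
          * F (indexType (Fin.cons t j : Fin (d + 1) → Fin n))
        = d.factorial * ∑' γ : Fin n →₀ ℕ, γ t * (if γ.degree = d + 1 then F γ else 0) := by
      intro t
      have h2 := ih fun β ↦ ((β t + 1 : ℕ) : ℝ≥0∞) * F (β + Finsupp.single t 1)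
      have h3 : Function.Injective fun β : Fin n →₀ ℕ ↦ β + Finsupp.single t 1 :=
        add_left_injective _
      rw [← h3.tsum_eq]
      · convert h2 using 1
        · refine Finset.sum_congr rfl fun j _ ↦ ?_
          rw [indexType_cons, add_comm (Finsupp.single t 1), multiFactorial_add_single]
          push_cast; ring
        · congr 1
          refine tsum_congr fun β ↦ ?_
          simp [map_add]
      · intro γ hγ
        have h0 : γ t ≠ 0 := by
          intro h
          simp [h] at hγ
        refine ⟨γ - Finsupp.single t 1, ?_⟩
        ext s
        rcases eq_or_ne t s with rfl | hs
        · simp; omega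
        · simp [hs]
    simp_rw [h1]
    rw [← Finset.mul_sum, ← Summable.tsum_finsetSum (f := fun (t : Fin n) (γ : Fin n →₀ ℕ) ↦
        (γ t : ℝ≥0∞) * (if γ.degree = d + 1 then F γ else 0)) fun _ _ ↦ ENNReal.summable,
      Nat.factorial_succ, Nat.cast_mul, mul_comm ((d + 1 : ℕ) : ℝ≥0∞), mul_assoc]
    congr 1
    rw [← ENNReal.tsum_mul_left]
    refine tsum_congr fun γ ↦ ?_
    rw [← Finset.sum_mul]
    by_cases hγ : γ.degree = d + 1
    · rw [← Nat.cast_sum, ← Finsupp.degree_eq_sum, hγ]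
    · simp [hγ]

/-- Blei's inequality with `d` indices in `ℓ²`, for a function of monomial exponents. -/
lemma sum_rpow_bhExp_le {n : ℕ} (B : (Fin n →₀ ℕ) → ℝ≥0∞) (hB : ∀ α, B α ≠ ∞) {m k d : ℕ}
    (hk : 1 ≤ k) (hm : m = k + d) :
    (∑ i : Fin m → Fin n, B (indexType i) ^ bhExp m) ^ (1 / bhExp m)
      ≤ (∑ i : Fin k → Fin n, ((∑ j : Fin d → Fin n, B (indexType i + indexType j) ^ 2)
        ^ (1 / 2 : ℝ)) ^ bhExp k) ^ (1 / bhExp k) := by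
  have e2 : ∀ a : ℝ≥0∞, (a ^ 2) ^ (1 / 2 : ℝ) = a := fun a ↦ by
    rw [← ENNReal.rpow_natCast, ← ENNReal.rpow_mul]; norm_num
  have e3 : ∀ a : ℝ≥0∞, (a ^ (1 / 2 : ℝ)) ^ 2 = a := fun a ↦ by
    rw [← ENNReal.rpow_natCast, ← ENNReal.rpow_mul]; norm_num
  induction d generalizing k with
  | zero =>
    subst hm
    refine le_of_eq ?_
    congr 1
    refine Finset.sum_congr rfl fun i _ ↦ ?_
    rw [Finset.univ_unique, Finset.sum_singleton, e2]
    simp [indexType]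
  | succ d ih =>
    refine (ih (k := k + 1) (by omega) (by omega)).trans ?_
    refine (sum_rpow_bhExp_succ_le hk (fun i : Fin (k + 1) → Fin n ↦ (∑ j : Fin d → Fin n,
      B (indexType i + indexType j) ^ 2) ^ (1 / 2 : ℝ)) (fun i ↦ ?_) fun j t i ↦ ?_).trans ?_
    · exact ENNReal.rpow_ne_top_of_nonneg (by norm_num)
        (ENNReal.sum_lt_top.mpr fun j _ ↦ ENNReal.pow_lt_top (hB _).lt_top).ne
    · simp only [indexType_insertNth, indexType_cons]
    · refine le_of_eq ?_
      congr 1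
      refine Finset.sum_congr rfl fun i _ ↦ ?_
      simp only [e3]
      rw [sum_cons]
      simp only [indexType_cons, add_left_comm, add_assoc]

/-- The coefficients `a_α` of `P` with the weights `(α! / m!)^r`, summed in `ℓ²` over the
multi-indices that extend `i`, against the `ℓ²` norm of the coefficients `(α! / β!) a_α` of the
derivative of `P` along `i`, where `α = β + indexType i`. -/
lemma sum_sq_indexType_le {n k d : ℕ} (P : MvPolynomial (Fin n) ℂ) (i : Fin k → Fin n) {r : ℝ}
    (hr : 1 / 2 ≤ r) :
    ∑ j : Fin d → Fin n, (((multiFactorial (indexType i + indexType j) : ℝ≥0∞)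
        / (k + d).factorial) ^ r * ‖P.coeff (indexType i + indexType j)‖ₑ) ^ 2
      ≤ (d.factorial : ℝ≥0∞) / (k + d).factorial * coeffWeight 1 (iterPderiv k i P) := by
  have hf0 : (((k + d).factorial : ℕ) : ℝ≥0∞) ≠ 0 := by exact_mod_cast (Nat.factorial_pos _).ne'
  have hft : (((k + d).factorial : ℕ) : ℝ≥0∞) ≠ ∞ := ENNReal.natCast_ne_top _
  have h1 := sum_multiFactorial_mul d fun β : Fin n →₀ ℕ ↦
    ‖(iterPderiv k i P).coeff β‖ₑ ^ 2 / (k + d).factorial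
  have h2 : ∀ j : Fin d → Fin n, (((multiFactorial (indexType i + indexType j) : ℝ≥0∞)
        / (k + d).factorial) ^ r * ‖P.coeff (indexType i + indexType j)‖ₑ) ^ 2
      ≤ multiFactorial (indexType j) *
        (‖(iterPderiv k i P).coeff (indexType j)‖ₑ ^ 2 / (k + d).factorial) := by
    intro j
    set β := indexType j
    set α := indexType i + β with hα
    have hdeg : α.degree = k + d := by simp [hα, β, map_add, degree_indexType]
    have hle : (multiFactorial α : ℝ≥0∞) / (k + d).factorial ≤ 1 := by
      rw [ENNReal.div_le_iff hf0 hft, one_mul]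
      have := multiFactorial_le_of_degree α
      rw [hdeg] at this
      exact_mod_cast this
    have h3 : (((multiFactorial α : ℝ≥0∞) / (k + d).factorial) ^ r) ^ 2
        ≤ (multiFactorial α : ℝ≥0∞) / (k + d).factorial := by
      rw [← ENNReal.rpow_natCast, ← ENNReal.rpow_mul]
      refine (ENNReal.rpow_le_rpow_of_exponent_ge hle (?_ : 1 ≤ r * (2 : ℕ))).trans_eq
        (ENNReal.rpow_one _)
      push_cast; linarith
    have h4 : ‖(iterPderiv k i P).coeff β‖ₑ * multiFactorial β
        = ‖P.coeff α‖ₑ * multiFactorial α := by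
      have := congrArg (fun c : ℂ ↦ ‖c‖ₑ) (coeff_iterPderiv i P β)
      simp only [enorm_mul] at this
      rw [add_comm β, ← hα] at this
      have hc : ∀ N : ℕ, ‖(N : ℂ)‖ₑ = (N : ℝ≥0∞) := fun N ↦ by
        rw [← ofReal_norm, Complex.norm_natCast, ENNReal.ofReal_natCast]
      rwa [hc, hc] at this
    have hβ0 : (multiFactorial β : ℝ≥0∞) ≠ 0 := by exact_mod_cast (multiFactorial_pos β).ne'
    have hβα : (multiFactorial β : ℝ≥0∞) ≤ multiFactorial α := by
      exact_mod_cast multiFactorial_mono (hα ▸ le_add_of_nonneg_left bot_le)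
    have h5 : (multiFactorial α : ℝ≥0∞) * ‖P.coeff α‖ₑ ^ 2
        ≤ multiFactorial β * ‖(iterPderiv k i P).coeff β‖ₑ ^ 2 := by
      refine (ENNReal.mul_le_mul_iff_left hβ0 (ENNReal.natCast_ne_top _)).mp ?_
      calc (multiFactorial α : ℝ≥0∞) * ‖P.coeff α‖ₑ ^ 2 * multiFactorial β
          ≤ (multiFactorial α : ℝ≥0∞) * ‖P.coeff α‖ₑ ^ 2 * multiFactorial α := by gcongr
        _ = (‖P.coeff α‖ₑ * multiFactorial α) ^ 2 := by ring
        _ = _ := by rw [← h4]; ring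
    rw [mul_pow]
    refine (mul_le_mul_left h3 _).trans ?_
    rw [ENNReal.div_eq_inv_mul, ENNReal.div_eq_inv_mul, mul_assoc, mul_left_comm _ _⁻¹]
    exact mul_le_mul_right h5 _
  refine (Finset.sum_le_sum fun j _ ↦ h2 j).trans ?_
  rw [h1, ENNReal.div_eq_inv_mul, mul_comm _ (d.factorial : ℝ≥0∞), mul_assoc]
  refine mul_le_mul_right ?_ _
  rw [coeffWeight, ← ENNReal.tsum_mul_left]
  refine ENNReal.tsum_le_tsum fun β ↦ ?_
  split_ifs with h
  · rw [one_pow, one_mul, ENNReal.div_eq_inv_mul]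
  · exact bot_le

/-- The Bohnenblust-Hille norm of the coefficients of an `m`-homogeneous polynomial is bounded by
the mixed norm that takes the `ℓ²` norms of the coefficients of the derivatives of order `k`. -/
theorem sum_coeff_rpow_le_sum_coeffWeight {n m k d : ℕ} (hk : 1 ≤ k) (hm : m = k + d)
    {P : MvPolynomial (Fin n) ℂ} (hP : P.IsHomogeneous m) :
    (∑ α ∈ P.support, ‖P.coeff α‖ₑ ^ bhExp m) ^ (1 / bhExp m)
      ≤ ((d.factorial : ℝ≥0∞) / m.factorial) ^ (1 / 2 : ℝ)
        * (∑ i : Fin k → Fin n, (coeffWeight 1 (iterPderiv k i P) ^ (1 / 2 : ℝ)) ^ bhExp k)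
          ^ (1 / bhExp k) := by
  have hq : 0 < bhExp m := bhExp_pos (by omega)
  have hqk : 0 < bhExp k := bhExp_pos hk
  have hq2 : 1 / 2 ≤ 1 / bhExp m := by
    refine one_div_le_one_div_of_le hq ?_
    rw [bhExp, div_le_iff₀ (by positivity)]; linarith
  have hf0 : ((m.factorial : ℕ) : ℝ≥0∞) ≠ 0 := by exact_mod_cast (Nat.factorial_pos _).ne'
  have hft : ((m.factorial : ℕ) : ℝ≥0∞) ≠ ∞ := ENNReal.natCast_ne_top _
  set B : (Fin n →₀ ℕ) → ℝ≥0∞ := fun α ↦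
    ((multiFactorial α : ℝ≥0∞) / m.factorial) ^ (1 / bhExp m) * ‖P.coeff α‖ₑ with hB
  have hBtop : ∀ α, B α ≠ ∞ := fun α ↦ ENNReal.mul_ne_top
    (ENNReal.rpow_ne_top_of_nonneg (by positivity)
      (ENNReal.div_ne_top (ENNReal.natCast_ne_top _) hf0)) enorm_ne_top
  have h1 : ∑ α ∈ P.support, ‖P.coeff α‖ₑ ^ bhExp m
      = ∑ i : Fin m → Fin n, B (indexType i) ^ bhExp m := by
    have h2 := sum_multiFactorial_mul m fun β : Fin n →₀ ℕ ↦ ‖P.coeff β‖ₑ ^ bhExp m / m.factorial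
    have h3 : ∀ i : Fin m → Fin n, B (indexType i) ^ bhExp m
        = multiFactorial (indexType i) * (‖P.coeff (indexType i)‖ₑ ^ bhExp m / m.factorial) := by
      intro i
      rw [hB, ENNReal.mul_rpow_of_nonneg _ _ hq.le, ← ENNReal.rpow_mul,
        one_div_mul_cancel hq.ne', ENNReal.rpow_one, ENNReal.div_eq_inv_mul, ENNReal.div_eq_inv_mul]
      ring
    rw [Finset.sum_congr rfl fun i _ ↦ h3 i, h2, ← ENNReal.tsum_mul_left,
      tsum_eq_sum (s := P.support)]
    · refine Finset.sum_congr rfl fun α hα ↦ ?_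
      have : α.degree = m := by
        by_contra hne
        exact (mem_support_iff.mp hα) (hP.coeff_eq_zero hne)
      rw [if_pos this, ENNReal.mul_div_cancel hf0 hft]
    · intro α hα
      simp [notMem_support_iff.mp hα, ENNReal.zero_rpow_of_pos hq]
  rw [h1]
  refine (sum_rpow_bhExp_le B hBtop hk hm).trans ?_
  have h4 : ∀ i : Fin k → Fin n, ((∑ j : Fin d → Fin n, B (indexType i + indexType j) ^ 2)
        ^ (1 / 2 : ℝ)) ^ bhExp k
      ≤ (((d.factorial : ℝ≥0∞) / m.factorial) ^ (1 / 2 : ℝ)) ^ bhExp k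
        * (coeffWeight 1 (iterPderiv k i P) ^ (1 / 2 : ℝ)) ^ bhExp k := by
    intro i
    rw [← ENNReal.mul_rpow_of_nonneg _ _ hqk.le, ← ENNReal.mul_rpow_of_nonneg _ _ (by norm_num)]
    refine ENNReal.rpow_le_rpow (ENNReal.rpow_le_rpow ?_ (by norm_num)) hqk.le
    have := sum_sq_indexType_le (d := d) P i hq2
    rwa [← hm] at this
  rw [one_div (bhExp k), ENNReal.rpow_inv_le_iff hqk, ENNReal.mul_rpow_of_nonneg _ _ hqk.le,
    ENNReal.rpow_inv_rpow hqk.ne', Finset.mul_sum]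
  exact Finset.sum_le_sum fun i _ ↦ h4 i

end Polarization

/-! ### The polynomial Bohnenblust-Hille constant -/

section Bound
open MvPolynomial MeasureTheory

lemma ofReal_coeffNorm {n m : ℕ} (hm : 1 ≤ m) (P : MvPolynomial (Fin n) ℂ) :
    ENNReal.ofReal (coeffNorm m P)
      = (∑ α ∈ P.support, ‖P.coeff α‖ₑ ^ bhExp m) ^ (1 / bhExp m) := by
  have hq := bhExp_pos hm
  have hm0 : (0 : ℝ) < m := by exact_mod_cast hm
  have e : ((m : ℝ) + 1) / (2 * m) = 1 / bhExp m := by rw [bhExp, one_div_div]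
  rw [coeffNorm, e, ← ENNReal.ofReal_rpow_of_nonneg (Finset.sum_nonneg fun _ _ ↦ by positivity)
    (by positivity), ENNReal.ofReal_sum_of_nonneg fun _ _ ↦ by positivity]
  congr 1
  refine Finset.sum_congr rfl fun α _ ↦ ?_
  rw [← ofReal_norm, ENNReal.ofReal_rpow_of_nonneg (norm_nonneg _) hq.le, bhExp]

/-- The Bohnenblust-Hille inequality of degree `m` obtained from the derivatives of order `k`, given
a comparison, with constant `K`, of the `L²` and the `L^p` norms of these derivatives. -/
theorem coeffNorm_le_of_iterPderiv {n m k d : ℕ} (hm : m = k + 1 + d)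
    {P : MvPolynomial (Fin n) ℂ} (hP : P.IsHomogeneous m) {K : ℝ} (hK0 : 0 ≤ K)
    (hK : ∀ i : Fin (k + 1) → Fin n, coeffWeight 1 (iterPderiv (k + 1) i P) ^ (1 / 2 : ℝ)
      ≤ ENNReal.ofReal K * (∫⁻ x, ‖eval (torusPt x) (iterPderiv (k + 1) i P)‖ₑ ^ bhExp (k + 1)
        ∂torusMeasure n) ^ (1 / bhExp (k + 1))) :
    coeffNorm m P ≤ ((d.factorial : ℝ) / m.factorial) ^ (1 / 2 : ℝ) * (K * (3 ^ k *
      (m ^ (k + 1) * Real.exp (k + 1 : ℕ) * polydiskNorm P))) := by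
  have hq : 0 < bhExp (k + 1) := bhExp_pos (by omega)
  have hpn := polydiskNorm_nonneg P
  rw [← ENNReal.ofReal_le_ofReal_iff (by positivity), ofReal_coeffNorm (by omega)]
  refine (sum_coeff_rpow_le_sum_coeffWeight (k := k + 1) (by omega) hm hP).trans ?_
  rw [ENNReal.ofReal_mul (by positivity), ENNReal.ofReal_mul hK0,
    ENNReal.ofReal_mul (by positivity),
    ← ENNReal.ofReal_rpow_of_nonneg (by positivity) (by norm_num),
    ENNReal.ofReal_div_of_pos (by exact_mod_cast Nat.factorial_pos _), ENNReal.ofReal_natCast,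
    ENNReal.ofReal_natCast]
  refine mul_le_mul_right ?_ _
  set A : ℝ := m ^ (k + 1) * Real.exp (k + 1 : ℕ) * polydiskNorm P
  -- `2 ^ (3 / 2)` is rounded up to `3`
  have h3 : ((2 : ℝ≥0∞) ^ (3 / 2 : ℝ)) ^ k ≤ ENNReal.ofReal (3 ^ k) := by
    rw [ENNReal.ofReal_pow (by norm_num)]
    refine pow_le_pow_left' ?_ k
    rw [show (2 : ℝ≥0∞) = ENNReal.ofReal 2 by simp,
      ENNReal.ofReal_rpow_of_nonneg (by norm_num) (by norm_num)]
    refine ENNReal.ofReal_le_ofReal ?_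
    refine le_of_pow_le_pow_left₀ two_ne_zero (by norm_num) ?_
    rw [← Real.rpow_natCast, ← Real.rpow_mul (by norm_num),
      show (3 / 2 : ℝ) * (2 : ℕ) = (3 : ℕ) by norm_num, Real.rpow_natCast]
    norm_num
  have hint : ∀ x, ∑ i : Fin (k + 1) → Fin n,
      ‖eval (torusPt x) (iterPderiv (k + 1) i P)‖ₑ ^ bhExp (k + 1)
      ≤ (ENNReal.ofReal (3 ^ k) * ENNReal.ofReal A) ^ bhExp (k + 1) := by
    intro x
    have := sum_enorm_iterPderiv_rpow_le (torusPt x) k P (ENNReal.ofReal A) fun w hw ↦ by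
      rw [← ofReal_norm]
      exact ENNReal.ofReal_le_ofReal (norm_eval_iterDirDeriv_le_polydiskNorm (by omega) hP w hw _
        fun t ↦ by simp [torusPt])
    rw [one_div, ENNReal.rpow_inv_le_iff hq] at this
    exact this.trans (by gcongr)
  rw [one_div (bhExp (k + 1)), ENNReal.rpow_inv_le_iff hq]
  have hK' : ∀ i : Fin (k + 1) → Fin n,
      (coeffWeight 1 (iterPderiv (k + 1) i P) ^ (1 / 2 : ℝ)) ^ bhExp (k + 1)
      ≤ ENNReal.ofReal K ^ bhExp (k + 1) * ∫⁻ x, ‖eval (torusPt x) (iterPderiv (k + 1) i P)‖ₑ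
        ^ bhExp (k + 1) ∂torusMeasure n := by
    intro i
    refine (ENNReal.rpow_le_rpow (hK i) hq.le).trans (le_of_eq ?_)
    rw [ENNReal.mul_rpow_of_nonneg _ _ hq.le, one_div (bhExp (k + 1)),
      ENNReal.rpow_inv_rpow hq.ne']
  refine (Finset.sum_le_sum fun i _ ↦ hK' i).trans ?_
  rw [← Finset.mul_sum, ← lintegral_finsetSum _ fun i _ ↦
    (measurable_enorm_eval_torusPt _).pow_const _, ENNReal.mul_rpow_of_nonneg _ _ hq.le]
  refine mul_le_mul_right ((lintegral_mono hint).trans_eq ?_) _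
  rw [lintegral_const, measure_univ, mul_one]

/-- The inequality `m! / (m - k)! ≥ m^k e^{-k}` for `m = k + d`. -/
lemma pow_mul_factorial_le (k d : ℕ) :
    ((k + d : ℕ) : ℝ) ^ k * d.factorial ≤ Real.exp k * (k + d).factorial := by
  induction d with
  | zero =>
    have := Real.pow_div_factorial_le_exp (k : ℝ) (by positivity) k
    rw [div_le_iff₀ (by positivity)] at this
    simpa using this
  | succ d ih =>
    have h1 : ((k + d : ℕ) + 1 : ℝ) ^ k * (d + 1) ≤ ((k + d : ℕ) + 1) * ((k + d : ℕ) : ℝ) ^ k := by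
      have hb := one_add_mul_le_pow (a := -(1 / ((k + d : ℕ) + 1 : ℝ)))
        (by
          have : 1 / ((k + d : ℕ) + 1 : ℝ) ≤ 1 := by
            rw [div_le_one (by positivity)]; linarith [(k + d).cast_nonneg (α := ℝ)]
          linarith) k
      have e1 : 1 + -(1 / ((k + d : ℕ) + 1 : ℝ)) = (k + d : ℕ) / ((k + d : ℕ) + 1) := by
        field_simp; ring
      have e2 : 1 + (k : ℝ) * -(1 / ((k + d : ℕ) + 1 : ℝ)) = (d + 1) / ((k + d : ℕ) + 1) := by
        push_cast; field_simp; ring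
      rw [e1, e2, div_pow, div_le_div_iff₀ (by positivity) (by positivity)] at hb
      linarith
    rw [← add_assoc, Nat.factorial_succ, Nat.factorial_succ]
    push_cast at h1 ih ⊢
    have hf : (0 : ℝ) ≤ d.factorial := by positivity
    nlinarith [mul_le_mul_of_nonneg_right h1 hf,
      mul_le_mul_of_nonneg_left ih (show (0 : ℝ) ≤ k + d + 1 by positivity)]

/-- The constants of `coeffNorm_le_of_iterPderiv` in closed form. -/
lemma coeffNorm_le_exp_mul {n m k d : ℕ} (hm : m = k + 1 + d)
    {P : MvPolynomial (Fin n) ℂ} (hP : P.IsHomogeneous m) {E : ℝ}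
    (hK : ∀ i : Fin (k + 1) → Fin n, coeffWeight 1 (iterPderiv (k + 1) i P) ^ (1 / 2 : ℝ)
      ≤ ENNReal.ofReal (Real.exp E) * (∫⁻ x, ‖eval (torusPt x) (iterPderiv (k + 1) i P)‖ₑ
        ^ bhExp (k + 1) ∂torusMeasure n) ^ (1 / bhExp (k + 1))) :
    coeffNorm m P ≤ Real.exp ((k + 1 : ℕ) / 2 * Real.log m + 4 * (k + 1 : ℕ) + E)
      * polydiskNorm P := by
  refine (coeffNorm_le_of_iterPderiv hm hP (Real.exp_pos E).le hK).trans ?_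
  have hm0 : (0 : ℝ) < m := by exact_mod_cast (show 0 < m by omega)
  have hp : ∀ l : ℕ, (m : ℝ) ^ l = Real.exp (l * Real.log m) := fun l ↦ by
    rw [Real.exp_nat_mul, Real.exp_log hm0]
  have h1 : ((d.factorial : ℝ) / m.factorial) ^ (1 / 2 : ℝ)
      ≤ Real.exp ((k + 1 : ℕ) / 2 - (k + 1 : ℕ) / 2 * Real.log m) := by
    have h2 : (d.factorial : ℝ) / m.factorial
        ≤ Real.exp ((k + 1 : ℕ) - (k + 1 : ℕ) * Real.log m) := by
      have := pow_mul_factorial_le (k + 1) d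
      rw [← hm, hp] at this
      rw [div_le_iff₀ (by positivity), Real.exp_sub, div_mul_eq_mul_div,
        le_div_iff₀ (Real.exp_pos _), mul_comm]
      exact this
    refine (Real.rpow_le_rpow (by positivity) h2 (by norm_num)).trans (le_of_eq ?_)
    rw [← Real.exp_mul]
    congr 1; ring
  have h3 : (3 : ℝ) ^ k ≤ Real.exp (2 * (k + 1 : ℕ)) := by
    have : (3 : ℝ) ≤ Real.exp 2 := by linarith [Real.add_one_le_exp (2 : ℝ)]
    refine (pow_le_pow_left₀ (by norm_num) this k).trans ?_
    rw [← Real.exp_nat_mul]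
    refine Real.exp_le_exp.mpr ?_
    push_cast; linarith
  have hpn := polydiskNorm_nonneg P
  calc _ ≤ Real.exp ((k + 1 : ℕ) / 2 - (k + 1 : ℕ) / 2 * Real.log m) * (Real.exp E *
        (Real.exp (2 * (k + 1 : ℕ)) * (Real.exp ((k + 1 : ℕ) * Real.log m) * Real.exp (k + 1 : ℕ)
          * polydiskNorm P))) := by
        rw [hp]
        gcongr
    _ = Real.exp (((k + 1 : ℕ) / 2 - (k + 1 : ℕ) / 2 * Real.log m) + E + 2 * (k + 1 : ℕ)
          + (k + 1 : ℕ) * Real.log m + (k + 1 : ℕ)) * polydiskNorm P := by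
        simp only [Real.exp_add]; ring
    _ ≤ _ := by
        refine mul_le_mul_of_nonneg_right (Real.exp_le_exp.mpr ?_) hpn
        have : (0 : ℝ) ≤ (k + 1 : ℕ) := Nat.cast_nonneg _
        linarith

/-- The bound obtained from the derivatives of order `m`. -/
lemma coeffNorm_le_exp_self {n m : ℕ} (hm : 1 ≤ m) {P : MvPolynomial (Fin n) ℂ}
    (hP : P.IsHomogeneous m) :
    coeffNorm m P ≤ Real.exp (m / 2 * Real.log m + 4 * m) * polydiskNorm P := by
  obtain ⟨k, rfl⟩ : ∃ k, m = k + 1 := ⟨m - 1, by omega⟩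
  refine (coeffNorm_le_exp_mul (k := k) (d := 0) (E := 0) rfl hP fun i ↦ ?_).trans_eq (by simp)
  have h := rpow_coeffWeight_le_lintegral_of_one_le (isHomogeneous_iterPderiv i hP)
    (one_le_bhExp (k := k + 1) (by omega))
  simpa using h

/-- The bound obtained from the derivatives of order `k`. -/
lemma coeffNorm_le_exp {n m k : ℕ} (hk : 3 ≤ k) (hkm : k ≤ m) {P : MvPolynomial (Fin n) ℂ}
    (hP : P.IsHomogeneous m) {δ : ℝ} (hδ : δ = 1 / ((k : ℝ) - 1)) :
    coeffNorm m P ≤ Real.exp (k / 2 * Real.log m + 4 * k + m / 2 * (δ + 2 * δ ^ 2))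
      * polydiskNorm P := by
  have hk3 : (3 : ℝ) ≤ k := by exact_mod_cast hk
  have hδ0 : 0 < δ := by rw [hδ]; exact one_div_pos.mpr (by linarith)
  have hδ2 : δ ≤ 1 / 2 := by
    rw [hδ]; exact one_div_le_one_div_of_le (by norm_num) (by linarith)
  -- `δ` is chosen so that `2 + 2δ = 2k / (k - 1)` is conjugate to `2k / (k + 1)`
  have hconj : (bhExp k).HolderConjugate (2 + 2 * δ) := by
    have hk1 : (k : ℝ) - 1 ≠ 0 := by linarith
    rw [Real.holderConjugate_iff]
    constructor
    · rw [bhExp, lt_div_iff₀ (by linarith)]; linarith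
    · rw [bhExp, hδ]
      have e : 2 + 2 * (1 / ((k : ℝ) - 1)) = 2 * k / (k - 1) := by field_simp; ring
      rw [e]; field_simp; ring
  obtain ⟨k, rfl⟩ : ∃ l, k = l + 1 := ⟨k - 1, by omega⟩
  refine coeffNorm_le_exp_mul (k := k) (d := m - (k + 1)) (by omega) hP fun i ↦ ?_
  refine (rpow_coeffWeight_le_lintegral hδ0 hδ2 (isHomogeneous_iterPderiv i hP) hconj).trans ?_
  refine mul_le_mul_left ?_ _
  rw [← ENNReal.ofReal_pow (by positivity), ENNReal.ofReal_rpow_of_nonneg (by positivity)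
    (by norm_num)]
  refine ENNReal.ofReal_le_ofReal ?_
  have h1 : 1 + δ + 2 * δ ^ 2 ≤ Real.exp (δ + 2 * δ ^ 2) := by
    linarith [Real.add_one_le_exp (δ + 2 * δ ^ 2)]
  have h2 : (1 + δ + 2 * δ ^ 2) ^ (m - (k + 1)) ≤ Real.exp (δ + 2 * δ ^ 2) ^ m :=
    (pow_le_pow_left₀ (by positivity) h1 _).trans
      (pow_le_pow_right₀ (Real.one_le_exp (by positivity)) (by omega))
  refine (Real.rpow_le_rpow (by positivity) h2 (by norm_num)).trans (le_of_eq ?_)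
  rw [← Real.exp_nat_mul, ← Real.exp_mul]
  congr 1; ring

lemma polBHConst_le_ofReal {m : ℕ} {c : ℝ} (hc : 0 ≤ c)
    (h : ∀ (n : ℕ) (P : MvPolynomial (Fin n) ℂ), P.IsHomogeneous m →
      coeffNorm m P ≤ c * polydiskNorm P) : polBHConst m ≤ ENNReal.ofReal c :=
  iInf₂_le_of_le c.toNNReal (fun n _ P hP ↦ by rw [Real.coe_toNNReal c hc]; exact h n P hP) le_rfl

/-- The exponent of `coeffNorm_le_exp` for `m = a²`, `log m = b²` and an order `N + 2` with
`N ≤ a / b < N + 1`. -/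
lemma exponent_le {a b N ε : ℝ} (hε : 0 < ε) (ha : 0 < a) (hb1 : 1 ≤ b) (hba : b ^ 2 ≤ a)
    (hN : N ≤ a / b) (hN1 : a / b < N + 1) (h12 : 12 ≤ ε * b ^ 2) (h24 : 24 ≤ ε * b ^ 2)
    (h6 : 6 ≤ ε * b) :
    (N + 2) / 2 * b ^ 2 + 4 * (N + 2)
      + a ^ 2 / 2 * (1 / (N + 2 - 1) + 2 * (1 / (N + 2 - 1)) ^ 2) ≤ (1 + ε) * (a * b) := by
  have hb0 : 0 < b := by linarith
  set s := a / b with hs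
  have hs0 : 0 < s := by positivity
  have hab : a * b = s * b ^ 2 := by rw [hs]; field_simp
  have t1 : (N + 2) / 2 * b ^ 2 ≤ a * b / 2 + b ^ 2 := by
    have := mul_le_mul_of_nonneg_right hN (sq_nonneg b)
    linarith
  have t2 : a ^ 2 / 2 * (1 / (N + 2 - 1) + 2 * (1 / (N + 2 - 1)) ^ 2) ≤ a * b / 2 + b ^ 2 := by
    have hδ : 1 / (N + 2 - 1) ≤ 1 / s := one_div_le_one_div_of_le hs0 (by linarith)
    have hδ0 : 0 < 1 / (N + 2 - 1) := one_div_pos.mpr (by linarith)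
    calc a ^ 2 / 2 * (1 / (N + 2 - 1) + 2 * (1 / (N + 2 - 1)) ^ 2)
        ≤ a ^ 2 / 2 * (1 / s + 2 * (1 / s) ^ 2) := by gcongr
      _ = a * b / 2 + b ^ 2 := by rw [hs]; field_simp
  have u1 : 12 * s ≤ ε * (a * b) := by
    have := mul_le_mul_of_nonneg_left h12 hs0.le
    rw [hab]; linarith
  have u2 : 24 ≤ ε * (a * b) := by
    have h1 : b ^ 2 ≤ a * b := hba.trans (le_mul_of_one_le_right ha.le hb1)
    exact h24.trans (mul_le_mul_of_nonneg_left h1 hε.le)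
  have u3 : 6 * b ^ 2 ≤ ε * (a * b) := by
    have := mul_le_mul hba h6 (by norm_num) ha.le
    linarith
  linarith

/-- Choice of the order `k ≈ √(m / log m)` of the derivatives, which balances the two main terms
`k log m / 2` and `m / (2k)` of the exponent. -/
lemma eventually_exists_exponent_le {ε : ℝ} (hε : 0 < ε) :
    ∀ᶠ m : ℕ in Filter.atTop, ∃ k : ℕ, 3 ≤ k ∧ k ≤ m ∧
      (k : ℝ) / 2 * Real.log m + 4 * k + m / 2 * (1 / ((k : ℝ) - 1) + 2 * (1 / ((k : ℝ) - 1)) ^ 2)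
        ≤ (1 + ε) * √(m * Real.log m) := by
  have hlog := (Real.tendsto_log_atTop.comp tendsto_natCast_atTop_atTop).eventually_ge_atTop
    (2 + 24 / ε + (6 / ε) ^ 2)
  have hsqrt := tendsto_natCast_atTop_atTop.eventually
    ((isLittleO_log_rpow_atTop (show (0 : ℝ) < 1 / 2 by norm_num)).bound one_pos)
  filter_upwards [hlog, hsqrt, Filter.eventually_ge_atTop 1] with m h1 h2 hm
  have hm0 : (0 : ℝ) < m := by exact_mod_cast hm
  simp only [Function.comp_apply] at h1
  have i2 : 0 < 24 / ε := by positivity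
  have i3 : 0 < (6 / ε) ^ 2 := by positivity
  have hL0 : 0 < Real.log m := by linarith
  have hLm : Real.log m ≤ √m := by
    rw [← Real.sqrt_eq_rpow, one_mul, Real.norm_of_nonneg hL0.le,
      Real.norm_of_nonneg (Real.sqrt_nonneg _)] at h2
    exact h2
  have hb1 : 1 ≤ √(Real.log m) := Real.one_le_sqrt.mpr (by linarith)
  have h6 : 6 / ε ≤ √(Real.log m) := Real.le_sqrt_of_sq_le (by linarith)
  have h24 : 24 / ε ≤ Real.log m := by linarith
  rw [div_le_iff₀ hε, mul_comm] at h6 h24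
  have ha2 : √(m : ℝ) ^ 2 = m := Real.sq_sqrt hm0.le
  have hb2 : √(Real.log m) ^ 2 = Real.log m := Real.sq_sqrt hL0.le
  have ha0 : 0 < √(m : ℝ) := Real.sqrt_pos.mpr hm0
  have hs0 : 0 ≤ √m / √(Real.log m) := by positivity
  have hsa : √m / √(Real.log m) ≤ √m := div_le_self ha0.le hb1
  have hs1 : 1 ≤ √m / √(Real.log m) := by
    rw [le_div_iff₀ (by linarith), one_mul]
    refine Real.sqrt_le_sqrt (hLm.trans ?_)
    nlinarith
  have hfl := Nat.floor_le hs0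
  refine ⟨⌊√m / √(Real.log m)⌋₊ + 2, ?_, ?_, ?_⟩
  · have := Nat.le_floor (n := 1) (a := √m / √(Real.log m)) (by simpa using hs1)
    omega
  · have h3 : √(m : ℝ) + 2 ≤ m := by nlinarith
    have : ((⌊√m / √(Real.log m)⌋₊ + 2 : ℕ) : ℝ) ≤ m := by
      push_cast; linarith
    exact_mod_cast this
  · have := exponent_le hε ha0 hb1 (by rwa [hb2]) hfl (Nat.lt_floor_add_one _)
      (by rw [hb2]; linarith) (by rwa [hb2]) h6
    rw [ha2, hb2, ← Real.sqrt_mul hm0.le] at this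
    push_cast
    exact this

end Bound

theorem theorem1p1 (κ₂ : ℝ) (hκ₂ : 1 < κ₂) :
    ∃ κ₁ : ℝ, 0 < κ₁ ∧ ∀ m : ℕ, 1 ≤ m →
      polBHConst m ≤ ENNReal.ofReal (κ₁ * Real.exp (κ₂ * √((m : ℝ) * Real.log m))) := by
  obtain ⟨m₀, hm₀⟩ := Filter.eventually_atTop.mp
    (eventually_exists_exponent_le (ε := κ₂ - 1) (by linarith))
  set f : ℕ → ℝ := fun m ↦ Real.exp (m / 2 * Real.log m + 4 * m)
  have hf : ∀ m ∈ Finset.range m₀, 0 ≤ f m := fun m _ ↦ (Real.exp_pos _).le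
  have hS := Finset.sum_nonneg hf
  refine ⟨1 + ∑ m ∈ Finset.range m₀, f m, by linarith, fun m hm ↦ ?_⟩
  have hR : 0 ≤ κ₂ * √((m : ℝ) * Real.log m) := by positivity
  rcases lt_or_ge m m₀ with h | h
  · refine (polBHConst_le_ofReal (Real.exp_pos _).le fun n P hP ↦
      coeffNorm_le_exp_self hm hP).trans (ENNReal.ofReal_le_ofReal ?_)
    have h1 : f m ≤ ∑ m ∈ Finset.range m₀, f m :=
      Finset.single_le_sum hf (Finset.mem_range.mpr h)
    have h2 := Real.one_le_exp hR
    change f m ≤ _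
    nlinarith
  · obtain ⟨k, hk3, hkm, hk⟩ := hm₀ m h
    refine (polBHConst_le_ofReal (Real.exp_pos _).le fun n P hP ↦
      coeffNorm_le_exp hk3 hkm hP rfl).trans (ENNReal.ofReal_le_ofReal ?_)
    rw [add_sub_cancel] at hk
    refine (Real.exp_le_exp.mpr hk).trans ?_
    nlinarith [Real.exp_pos (κ₂ * √((m : ℝ) * Real.log m))]
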